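/- Let $X$ be a complex Banach space and let $(T(t))_{t\ge 0}$ be a $C_0$-semigroup on $X$ with generator $A:D(A)\to X$, spectrum $\sigma(A)$ and resolvent $R(z,A)=(z-A)^{-1}$ for $z\in\mathbb C\setminus\sigma(A)$. Assume that there are $a\in(0,\infty)$ and $\theta\in(\tfrac12,\infty)$ such that $it\notin\sigma(A)$ for all real $t$ with $|t|\ge a$, and $$\sup\{|t|^{\theta}\,\|R(it,A)\| : t\in\mathbb R,\ |t|\ge a\}<\infty .$$ Let $\phi\in L^\infty(\mathbb R,X)$ have Beurling spectrum $$sp(\phi)=\Big\{\omega\in\mathbb R : \text{for all } f\in L^1(\mathbb R,\mathbb C),\ \phi*f=0 \text{ implies } \int_{\mathbb R} f(t)e^{-i\omega t}\,dt=0\Big\},$$ and assume that $i\,sp(\phi)\cap\sigma(A)=\emptyset$. Then the equation $u'=Au+\phi$ has a mild solution on $\mathbb R$ which is bounded and uniformly continuous: there is a bounded and uniformly continuous function $u:\mathbb R\to X$ such that, for every $t\in\mathbb R$, $\int_0^t u(s)\,ds\in D(A)$ and $$u(t)=u(0)+A\int_0^t u(s)\,ds+\int_0^t\phi(s)\,ds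 .$$ -/

import Mathlib

open Filter Topology MeasureTheory
open scoped NNReal

namespace EvolutionEquation

/-- A `C₀`-semigroup (strongly continuous one-parameter semigroup) of bounded linear operators
on a complex Banach space `X`. -/
structure C0Semigroup (X : Type*) [NormedAddCommGroup X] [NormedSpace ℂ X] where
  /-- The operators `T(t)`, `t ≥ 0`. -/
  op : ℝ≥0 → X →L[ℂ] X
  op_zero : op 0 = ContinuousLinearMap.id ℂ X
  op_add : ∀ s t : ℝ≥0, op (s + t) = (op s).comp (op t)
  tendsto_op : ∀ x : X, Tendsto (fun t : ℝ≥0 => op t x) (𝓝[>] 0) (𝓝 x)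

section Operators

variable {X : Type*} [NormedAddCommGroup X] [NormedSpace ℂ X]

/-- `y` is the right derivative at `0` of the orbit `t ↦ T(t) x`. -/
def C0Semigroup.HasRightDerivAtZero (T : C0Semigroup X) (x y : X) : Prop :=
  Tendsto (fun h : ℝ≥0 => (h : ℝ)⁻¹ • (T.op h x - x)) (𝓝[>] 0) (𝓝 y)

theorem C0Semigroup.HasRightDerivAtZero.add {T : C0Semigroup X} {x y x' y' : X}
    (h : T.HasRightDerivAtZero x y) (h' : T.HasRightDerivAtZero x' y') :
    T.HasRightDerivAtZero (x + x') (y + y') := by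
  refine (Tendsto.add h h').congr fun t => ?_
  rw [← smul_add, map_add]
  congr 1
  abel

theorem C0Semigroup.HasRightDerivAtZero.smul {T : C0Semigroup X} {x y : X} (c : ℂ)
    (h : T.HasRightDerivAtZero x y) : T.HasRightDerivAtZero (c • x) (c • y) := by
  refine (Tendsto.const_smul h c).congr fun t => ?_
  rw [map_smul, ← smul_sub, smul_comm]

theorem C0Semigroup.HasRightDerivAtZero.unique {T : C0Semigroup X} {x y y' : X}
    (h : T.HasRightDerivAtZero x y) (h' : T.HasRightDerivAtZero x y') : y = y' :=
  tendsto_nhds_unique h h'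

/-- The infinitesimal generator `A` of `T`: `D(A)` is the set of all `x` for which
`lim_{h ↓ 0} (T(h) x - x) / h` exists, and `A x` is this limit. -/
noncomputable def C0Semigroup.generator (T : C0Semigroup X) : X →ₗ.[ℂ] X where
  domain :=
    { carrier := {x | ∃ y, T.HasRightDerivAtZero x y}
      add_mem' := fun ⟨_, hy⟩ ⟨_, hz⟩ => ⟨_, hy.add hz⟩
      zero_mem' := ⟨0, by simp [C0Semigroup.HasRightDerivAtZero]⟩
      smul_mem' := fun c _ ⟨_, hy⟩ => ⟨_, hy.smul c⟩ }
  toFun :=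
    { toFun := fun x => Classical.choose x.2
      map_add' := fun x x' => (Classical.choose_spec (x + x').2).unique
        ((Classical.choose_spec x.2).add (Classical.choose_spec x'.2))
      map_smul' := fun c x => (Classical.choose_spec (c • x).2).unique
        ((Classical.choose_spec x.2).smul c) }

theorem C0Semigroup.mem_generator_domain_iff (T : C0Semigroup X) (x : X) :
    x ∈ T.generator.domain ↔ ∃ y, T.HasRightDerivAtZero x y := Iff.rfl

theorem C0Semigroup.generator_spec (T : C0Semigroup X) (x : T.generator.domain) :
    T.HasRightDerivAtZero x (T.generator x) :=
  Classical.choose_spec x.2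

/-- The bounded operator `R` is the two-sided inverse of `z - A : D(A) → X`. -/
def IsResolventAt (A : X →ₗ.[ℂ] X) (z : ℂ) (R : X →L[ℂ] X) : Prop :=
  (∀ x : X, ∃ h : R x ∈ A.domain, z • R x - A ⟨R x, h⟩ = x) ∧
    ∀ x : A.domain, R (z • (x : X) - A x) = x

theorem IsResolventAt.unique {A : X →ₗ.[ℂ] X} {z : ℂ} {R S : X →L[ℂ] X}
    (hR : IsResolventAt A z R) (hS : IsResolventAt A z S) : R = S := by
  ext x
  obtain ⟨h, hx⟩ := hS.1 x
  have := hR.2 ⟨S x, h⟩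
  simp only [hx] at this
  exact this

/-- The spectrum `σ(A)` of an (unbounded) operator: the set of all `z` for which `z - A` has no
bounded inverse. -/
def opSpectrum (A : X →ₗ.[ℂ] X) : Set ℂ := {z | ¬ ∃ R, IsResolventAt A z R}

open Classical in
/-- The resolvent `R(z, A) = (z - A)⁻¹` for `z ∉ σ(A)` (with the value `0` for `z ∈ σ(A)`). -/
noncomputable def opResolvent (A : X →ₗ.[ℂ] X) (z : ℂ) : X →L[ℂ] X :=
  if h : ∃ R, IsResolventAt A z R then Classical.choose h else 0

theorem opResolvent_spec {A : X →ₗ.[ℂ] X} {z : ℂ} (hz : z ∉ opSpectrum A) :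
    IsResolventAt A z (opResolvent A z) := by
  have h : ∃ R, IsResolventAt A z R := not_not.mp hz
  rw [opResolvent, dif_pos h]
  exact Classical.choose_spec h

/-- The set `K = (1/i) (iℝ ∩ σ(A))` of all real `t` with `i t ∈ σ(A)`. -/
def imagSpectrum (A : X →ₗ.[ℂ] X) : Set ℝ := {t | Complex.I * (t : ℂ) ∈ opSpectrum A}

/-- `u` is a mild solution on `ℝ` of `u' = A u + φ`, for locally integrable `φ`. -/
def IsMildSolution (A : X →ₗ.[ℂ] X) (φ u : ℝ → X) : Prop :=
  Continuous u ∧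
    ∃ h : ∀ t : ℝ, (∫ s in (0 : ℝ)..t, u s) ∈ A.domain,
      ∀ t : ℝ, u t = u 0 + A ⟨∫ s in (0 : ℝ)..t, u s, h t⟩ + ∫ s in (0 : ℝ)..t, φ s

/-- The Beurling spectrum of `φ ∈ L^∞(ℝ, X)`: the set of all real `ω` such that every
`f ∈ L¹(ℝ, ℂ)` with `f * φ = 0` has `∫ f(t) e^{-iωt} dt = 0`. -/
def beurlingSpectrum (φ : ℝ → X) : Set ℝ :=
  {ω | ∀ f : ℝ → ℂ, Integrable f volume →
    convolution f φ (ContinuousLinearMap.lsmul ℂ ℂ) volume = 0 →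
    ∫ t : ℝ, f t * Complex.exp (-(Complex.I * ω * t)) = 0}

/-- The bounded uniformly continuous functions `ℝ → X`. -/
def BUC (X : Type*) [NormedAddCommGroup X] : Set (ℝ → X) :=
  {u | (∃ C : ℝ, ∀ t, ‖u t‖ ≤ C) ∧ UniformContinuous u}

end Operators

end EvolutionEquation

/-! The solution is a convolution `u = G ⋆ φ`, where `G` is an integrable operator-valued kernel
with `𝓕 G s = (1 - χ s) R(2πis, A)` and `χ = 𝓕 k` is a smooth cutoff equal to `1` near the compact
imaginary spectrum. Since `G` is in `L¹` and `φ` in `L^∞`, `u` is bounded and uniformly continuous.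

The cutoff costs nothing if `k ⋆ φ = 0`. Such a `k` exists by a local Wiener argument
(`exists_annihilating_radius`, `exists_annihilating_cutoff`): no point of the imaginary spectrum
lies in `sp(φ)`, so near each of them every band-limited function annihilates `φ`.

For `θ ≤ 1` the multiplier `m = 𝓕 G` need not be integrable. However, the `k`-th derivative of the
resolvent is a multiple of its power `k + 1`, so from `k = 1` on the derivatives of `m` decay with
order `2θ > 1`. As `m` vanishes at infinity, `m'` has integral zero, so `𝓕 m'` is Hölder at `0`; it
also decays like `t⁻²`. Division by `t` gives an integrable kernel
(`exists_integrable_fourier_eq_of_decay`).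

The equation is checked after applying one bounded resolvent `R = R(z, A)`. On the Fourier side it
is then the resolvent identity (`fundamental_solution_ae_eq`), and solving for `∫ u` places it in
the range of `R`, that is, in `D(A)`. -/

namespace EvolutionEquation

open scoped Convolution FourierTransform ENNReal
open Set

/-! ### Convolution of integrable with bounded functions; uniqueness of the Fourier transform. -/

section L1Conv

variable {E E' F : Type*} [NormedAddCommGroup E] [NormedSpace ℂ E]
  [NormedAddCommGroup E'] [NormedSpace ℂ E'] [NormedAddCommGroup F] [NormedSpace ℂ F]

theorem convolutionExistsAt_of_integrable_of_bdd {𝕜 : Type*} [NontriviallyNormedField 𝕜]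
    {E E' F : Type*} [NormedAddCommGroup E] [NormedSpace 𝕜 E]
    [NormedAddCommGroup E'] [NormedSpace 𝕜 E'] [NormedAddCommGroup F] [NormedSpace 𝕜 F]
    (L : E →L[𝕜] E' →L[𝕜] F)
    {f : ℝ → E} {φ : ℝ → E'} (hf : Integrable f) (hφ : AEStronglyMeasurable φ) {C : ℝ}
    (hC : ∀ᵐ x, ‖φ x‖ ≤ C) (x : ℝ) : ConvolutionExistsAt f φ x L volume := by
  refine Integrable.mono' ((hf.norm.const_mul ‖L‖).mul_const C)
    (hf.aestronglyMeasurable.convolution_integrand_snd L hφ x) ?_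
  have h := (quasiMeasurePreserving_sub_left_of_right_invariant (volume : Measure ℝ) x).ae hC
  filter_upwards [h] with t ht
  exact (L.le_opNorm₂ _ _).trans (by gcongr)

theorem norm_convolution_le_of_bdd (L : E →L[ℂ] E' →L[ℂ] F)
    {f : ℝ → E} {φ : ℝ → E'} (hf : Integrable f) {C : ℝ}
    (hC : ∀ᵐ x, ‖φ x‖ ≤ C) (x : ℝ) : ‖(f ⋆[L] φ) x‖ ≤ ‖L‖ * (∫ t, ‖f t‖) * C := by
  have h := (quasiMeasurePreserving_sub_left_of_right_invariant (volume : Measure ℝ) x).ae hC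
  rw [convolution_def]
  refine (norm_integral_le_of_norm_le ((hf.norm.const_mul ‖L‖).mul_const C) ?_).trans_eq ?_
  · filter_upwards [h] with t ht
    exact (L.le_opNorm₂ _ _).trans (by gcongr)
  · rw [integral_mul_const, integral_const_mul]

/-- Continuity of translation in `L¹`, read off from the continuous action of `ℝᵈᵃᵃ` on `Lp`. -/
theorem tendsto_lintegral_enorm_comp_add_sub {E : Type*} [NormedAddCommGroup E] {f : ℝ → E} (hf : Integrable f) :
    Tendsto (fun h : ℝ => ∫⁻ t, ‖f (h + t) - f t‖ₑ) (𝓝 0) (𝓝 0) := by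
  have hm : MemLp f 1 volume := memLp_one_iff_integrable.2 hf
  have : Fact ((1 : ℝ≥0∞) ≠ ∞) := ⟨ENNReal.one_ne_top⟩
  have h1 : Continuous fun c : ℝᵈᵃᵃ => c +ᵥ hm.toLp f := continuous_id.vadd continuous_const
  have h2 : Continuous fun h : ℝ => (DomAddAct.mk h : ℝᵈᵃᵃ) +ᵥ hm.toLp f :=
    h1.comp DomAddAct.continuous_mk
  have h3 : Tendsto (fun h : ℝ => ‖((DomAddAct.mk h : ℝᵈᵃᵃ) +ᵥ hm.toLp f) - hm.toLp f‖ₑ)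
      (𝓝 0) (𝓝 0) := by
    have := ((h2.sub (continuous_const (y := hm.toLp f))).enorm).tendsto 0
    simpa using this
  refine h3.congr fun h => ?_
  rw [DomAddAct.mk_vadd_toLp, ← MemLp.toLp_sub, Lp.enorm_toLp, eLpNorm_one_eq_lintegral_enorm]
  rfl

/-- A shift of the argument can be moved onto `f`, where translation is continuous in `L¹`; the
estimate is independent of the point. -/
theorem uniformContinuous_convolution (L : E →L[ℂ] E' →L[ℂ] F)
    {f : ℝ → E} {φ : ℝ → E'} (hf : Integrable f) (hφ : AEStronglyMeasurable φ) {C : ℝ}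
    (hC : ∀ᵐ x, ‖φ x‖ ≤ C) : UniformContinuous (f ⋆[L] φ) := by
  have key : ∀ x h : ℝ, ‖(f ⋆[L] φ) (x + h) - (f ⋆[L] φ) x‖ ≤
      ‖L‖ * (∫ t, ‖f (h + t) - f t‖) * C := by
    intro x h
    have hf' : Integrable fun t => f (h + t) := hf.comp_add_left h
    have e : (f ⋆[L] φ) (x + h) = ((fun t => f (h + t)) ⋆[L] φ) x := by
      rw [convolution_def, convolution_def,
        ← integral_add_left_eq_self (fun t => L (f t) (φ (x + h - t))) h]
      congr 1; ext t; congr 2; ring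
    have e2 : (f ⋆[L] φ) (x + h) - (f ⋆[L] φ) x = ((fun t => f (h + t) - f t) ⋆[L] φ) x := by
      rw [e, convolution_def, convolution_def, convolution_def, ← integral_sub]
      · simp
      · exact convolutionExistsAt_of_integrable_of_bdd L hf' hφ hC x
      · exact convolutionExistsAt_of_integrable_of_bdd L hf hφ hC x
    rw [e2]
    exact norm_convolution_le_of_bdd L (hf'.sub hf) hC x
  have h0 : Tendsto (fun h : ℝ => ‖L‖ * (∫ t, ‖f (h + t) - f t‖) * C) (𝓝 0) (𝓝 0) := by
    have h1 := (ENNReal.tendsto_toReal ENNReal.zero_ne_top).comp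
      (tendsto_lintegral_enorm_comp_add_sub hf)
    have h2 : Tendsto (fun h : ℝ => ∫ t, ‖f (h + t) - f t‖) (𝓝 0) (𝓝 0) := by
      refine h1.congr fun h => ?_
      exact (integral_norm_eq_lintegral_enorm
        ((hf.comp_add_left h).sub hf).aestronglyMeasurable).symm
    simpa using (h2.const_mul ‖L‖).mul_const C
  rw [Metric.uniformContinuous_iff]
  intro ε hε
  obtain ⟨δ, hδ, h⟩ := Metric.eventually_nhds_iff.1 (h0.eventually (gt_mem_nhds hε))
  refine ⟨δ, hδ, fun {a b} hab => ?_⟩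
  have := key b (a - b)
  rw [add_sub_cancel] at this
  rw [dist_eq_norm]
  refine this.trans_lt (h ?_)
  rwa [dist_zero_right, ← dist_eq_norm]

theorem convolution_assoc_of_bdd {E₁ E₂ E₃ E₁₂ E₂₃ F : Type*}
    [NormedAddCommGroup E₁] [NormedSpace ℂ E₁] [NormedAddCommGroup E₂] [NormedSpace ℂ E₂]
    [NormedAddCommGroup E₃] [NormedSpace ℂ E₃] [NormedAddCommGroup E₁₂] [NormedSpace ℂ E₁₂]
    [NormedAddCommGroup E₂₃] [NormedSpace ℂ E₂₃] [NormedAddCommGroup F] [NormedSpace ℂ F]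
    [CompleteSpace E₁₂] [CompleteSpace E₂₃] [CompleteSpace F]
    (L : E₁ →L[ℂ] E₂ →L[ℂ] E₁₂) (L₂ : E₁₂ →L[ℂ] E₃ →L[ℂ] F)
    (L₃ : E₁ →L[ℂ] E₂₃ →L[ℂ] F) (L₄ : E₂ →L[ℂ] E₃ →L[ℂ] E₂₃)
    (hL : ∀ x y z, L₂ (L x y) z = L₃ x (L₄ y z))
    {f : ℝ → E₁} {g : ℝ → E₂} {φ : ℝ → E₃} (hf : Integrable f) (hg : Integrable g)
    (hφ : AEStronglyMeasurable φ) {C : ℝ} (hC : ∀ᵐ x, ‖φ x‖ ≤ C) :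
    (f ⋆[L] g) ⋆[L₂] φ = f ⋆[L₃] (g ⋆[L₄] φ) := by
  ext x
  have hC' : ∀ᵐ x, ‖(‖φ x‖ : ℝ)‖ ≤ C := by simpa using hC
  refine convolution_assoc L L₂ L₃ L₄ hL hf.aestronglyMeasurable hg.aestronglyMeasurable hφ
    (hf.ae_convolution_exists L hg) (Eventually.of_forall fun y =>
      convolutionExistsAt_of_integrable_of_bdd _ hg.norm hφ.norm hC' y) ?_
  have hm : AEStronglyMeasurable
      ((fun x => ‖g x‖) ⋆[ContinuousLinearMap.mul ℝ ℝ] fun x => ‖φ x‖) := by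
    exact AEStronglyMeasurable.integral_prod_right'
      (hg.norm.aestronglyMeasurable.convolution_integrand _ hφ.norm)
  refine convolutionExistsAt_of_integrable_of_bdd _ hf.norm hm
    (C := (∫ t, ‖g t‖) * C) (Eventually.of_forall fun y => ?_) x
  have h := (quasiMeasurePreserving_sub_left_of_right_invariant (volume : Measure ℝ) y).ae hC
  rw [convolution_def]
  refine (norm_integral_le_of_norm_le (hg.norm.mul_const C) ?_).trans_eq ?_
  · filter_upwards [h] with t ht
    simp only [ContinuousLinearMap.mul_apply', norm_mul, norm_norm]
    gcongr
  · rw [integral_mul_const]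

/-- No integrability of `𝓕 f` is needed: a test function is the transform of a Schwartz function,
and self-adjointness of `𝓕` turns its pairing with `f` into a pairing with `𝓕 f`. -/
theorem ae_eq_of_fourier_eq [CompleteSpace E] {f g : ℝ → E} (hf : Integrable f)
    (hg : Integrable g) (h : 𝓕 f = 𝓕 g) : f =ᵐ[volume] g := by
  refine ae_eq_of_integral_contDiff_smul_eq hf.locallyIntegrable hg.locallyIntegrable ?_
  intro q hq hqc
  set Q : SchwartzMap ℝ ℂ := HasCompactSupport.toSchwartzMap (f := fun x => (q x : ℂ))
    (hqc.comp_left (g := ((↑) : ℝ → ℂ)) (by simp)) (Complex.ofRealCLM.contDiff.comp hq) with hQ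
  have hqQ : ∀ x, (q x : ℂ) = 𝓕 (⇑(𝓕⁻ Q : SchwartzMap ℝ ℂ)) x := by
    intro x
    rw [← SchwartzMap.fourier_coe, FourierTransform.fourier_fourierInv_eq]
    rfl
  have key : ∀ f : ℝ → E, Integrable f → ∫ x, q x • f x = ∫ x, (𝓕⁻ Q : SchwartzMap ℝ ℂ) x • 𝓕 f x := by
    intro f hf
    have := VectorFourier.integral_fourierIntegral_smul_eq_flip (μ := volume) (ν := volume)
      (L := innerₗ ℝ) Real.continuous_fourierChar continuous_inner
      (SchwartzMap.integrable (𝓕⁻ Q : SchwartzMap ℝ ℂ)) hf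
    rw [flip_innerₗ] at this
    refine Eq.trans ?_ this
    congr 1; ext x
    rw [← Complex.coe_smul, hqQ]
    rfl
  rw [key f hf, key g hg, h]

theorem convolution_congr_left (L : E →L[ℂ] E' →L[ℂ] F) {f g : ℝ → E} (φ : ℝ → E')
    (h : f =ᵐ[volume] g) : f ⋆[L] φ = g ⋆[L] φ :=
  convolution_congr L h EventuallyEq.rfl

end L1Conv

/-! ### Local Wiener lemma: functions annihilating `φ` and a cutoff among them. -/

section WienerLocalization

theorem fourier_add_of_integrable {E : Type*} [NormedAddCommGroup E] [NormedSpace ℂ E]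
    {f g : ℝ → E} (hf : Integrable f) (hg : Integrable g) :
    𝓕 (f + g) = 𝓕 f + 𝓕 g := by
  ext s
  have h : ∀ {u : ℝ → E}, Integrable u → Integrable fun x => Real.fourierChar (-(x * s)) • u x := by
    intro u hu
    have := (Real.fourierIntegral_convergent_iff (μ := volume) (f := u) s).2 hu
    simpa [mul_comm] using this
  simp only [Pi.add_apply, Real.fourier_real_eq, smul_add]
  exact integral_add (h hf) (h hg)

theorem fourier_const_smul {E : Type*} [NormedAddCommGroup E] [NormedSpace ℂ E]
    (a : ℂ) (f : ℝ → E) (s : ℝ) : 𝓕 (a • f) s = a • 𝓕 f s := by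
  simp only [Pi.smul_apply, Real.fourier_real_eq, smul_comm _ a, integral_smul]

/-- Every test function is the Fourier transform of an integrable function. -/
theorem exists_integrable_fourier_eq {q : ℝ → ℂ} (hq : ContDiff ℝ (⊤ : ℕ∞) q)
    (hc : HasCompactSupport q) : ∃ V : SchwartzMap ℝ ℂ, 𝓕 (⇑V) = q := by
  refine ⟨𝓕⁻ (hc.toSchwartzMap hq), ?_⟩
  rw [← SchwartzMap.fourier_coe, FourierTransform.fourier_fourierInv_eq]
  rfl

theorem exists_complex_bump (ω : ℝ) {r : ℝ} (hr : 0 < r) : ∃ q : ℝ → ℂ,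
    ContDiff ℝ (⊤ : ℕ∞) q ∧ HasCompactSupport q ∧ (∀ s, |s - ω| ≤ r → q s = 1) ∧
    ∀ s, 2 * r ≤ |s - ω| → q s = 0 := by
  let b : ContDiffBump ω := ⟨r, 2 * r, hr, by linarith⟩
  refine ⟨fun s => (b s : ℂ), Complex.ofRealCLM.contDiff.comp b.contDiff,
    b.hasCompactSupport.comp_left (g := ((↑) : ℝ → ℂ)) (by simp), fun s hs => ?_, fun s hs => ?_⟩
  · have : b s = 1 := b.one_of_mem_closedBall (by simpa [Real.dist_eq] using hs)
    simp [this]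
  · have : b s = 0 := b.zero_of_le_dist (by simpa [Real.dist_eq] using hs)
    simp [this]

/-- The `L¹`-normalized dilation of `V`, modulated to frequency `ω`. -/
noncomputable def modDilate (V : ℝ → ℂ) (ω δ : ℝ) (t : ℝ) : ℂ :=
  δ * (Real.fourierChar (ω * t) * V (δ * t))

theorem integrable_modDilate {V : ℝ → ℂ} (hV : Integrable V) (ω : ℝ) {δ : ℝ} (hδ : 0 < δ) :
    Integrable (modDilate V ω δ) := by
  refine Integrable.const_mul ?_ _
  refine (hV.comp_mul_left' hδ.ne').bdd_mul (c := 1) ?_ ?_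
  · have := Real.continuous_fourierChar
    fun_prop
  · exact Eventually.of_forall fun t => (Circle.norm_coe _).le

theorem fourier_modDilate (V : ℝ → ℂ) (ω : ℝ) {δ : ℝ} (hδ : 0 < δ) (s : ℝ) :
    𝓕 (modDilate V ω δ) s = 𝓕 V ((s - ω) / δ) := by
  rw [Real.fourier_real_eq, Real.fourier_real_eq]
  have h := Measure.integral_comp_mul_left
    (fun t => Real.fourierChar (-(t * ((s - ω) / δ))) • V t) δ
  have h2 : ∀ t : ℝ, Real.fourierChar (-(t * s)) • modDilate V ω δ t =
      (δ : ℂ) * (Real.fourierChar (-(δ * t * ((s - ω) / δ))) • V (δ * t)) := by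
    intro t
    have : -(δ * t * ((s - ω) / δ)) = -(t * s) + ω * t := by field_simp; ring
    rw [this, AddChar.map_add_eq_mul]
    simp only [modDilate, Circle.smul_def, Circle.coe_mul, smul_eq_mul]
    ring
  simp_rw [h2]
  rw [integral_const_mul, h, abs_of_pos (inv_pos.2 hδ), ← Complex.coe_smul, smul_eq_mul,
    ← mul_assoc, ← Complex.ofReal_mul, mul_inv_cancel₀ hδ.ne', Complex.ofReal_one, one_mul]

/-- Writing `𝓕 f ω` as an integral over `x`, its character combines with the modulation of
`modDilate`, so both terms carry the same phase and only a translation of `V` by `δ x` remains.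
Hence convolution with `f` acts on a narrow band around `ω` almost as the scalar `𝓕 f ω`. -/
theorem lintegral_enorm_modDilate_sub_le (V : SchwartzMap ℝ ℂ) {f : ℝ → ℂ} (hf : Integrable f)
    (ω : ℝ) {δ : ℝ} (hδ : 0 < δ) :
    ∫⁻ t, ‖𝓕 f ω * modDilate V ω δ t -
        (f ⋆[ContinuousLinearMap.mul ℂ ℂ] modDilate V ω δ) t‖ₑ ≤
      ∫⁻ x, ‖f x‖ₑ * ∫⁻ t, ‖V (-(δ * x) + t) - V t‖ₑ := by
  have hV := V.integrable (μ := volume)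
  have hW := integrable_modDilate hV ω hδ
  have hcf := Real.continuous_fourierChar
  have hVc := V.continuous
  let k : ℝ → ℝ → ℝ≥0∞ := fun x t =>
    ‖f x‖ₑ * (ENNReal.ofReal δ * ‖V (-(δ * x) + δ * t) - V (δ * t)‖ₑ)
  have hpt : ∀ᵐ t, ‖𝓕 f ω * modDilate V ω δ t -
        (f ⋆[ContinuousLinearMap.mul ℂ ℂ] modDilate V ω δ) t‖ₑ ≤ ∫⁻ x, k x t := by
    filter_upwards [hf.ae_convolution_exists (ContinuousLinearMap.mul ℂ ℂ) hW] with t ht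
    have h1 : Integrable fun x => Real.fourierChar (-(x * ω)) • f x := by
      have := (Real.fourierIntegral_convergent_iff (μ := volume) (f := f) ω).2 hf
      simpa [mul_comm] using this
    rw [Real.fourier_real_eq, ← integral_mul_const, convolution_def, ← integral_sub
      (h1.mul_const _) ht]
    refine (enorm_integral_le_lintegral_enorm _).trans (lintegral_mono fun x => ?_)
    have : (Real.fourierChar (-(x * ω)) • f x) * modDilate V ω δ t -
        (ContinuousLinearMap.mul ℂ ℂ) (f x) (modDilate V ω δ (t - x)) =
        f x * (δ * ((Real.fourierChar (ω * (t - x)) : ℂ) *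
          -(V (-(δ * x) + δ * t) - V (δ * t)))) := by
      have e1 : Real.fourierChar (ω * (t - x)) =
          Real.fourierChar (-(x * ω)) * Real.fourierChar (ω * t) := by
        rw [← AddChar.map_add_eq_mul]; congr 1; ring
      have e2 : δ * (t - x) = -(δ * x) + δ * t := by ring
      simp only [modDilate, Circle.smul_def, smul_eq_mul, ContinuousLinearMap.mul_apply', e1, e2,
        Circle.coe_mul]
      ring
    rw [this]
    simp only [k, enorm_mul, enorm_neg]
    gcongr
    · rw [← ofReal_norm, Complex.norm_real, Real.norm_of_nonneg hδ.le]
    · rw [← ofReal_norm (E := ℂ) (Real.fourierChar _ : ℂ), Circle.norm_coe, ENNReal.ofReal_one,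
        one_mul]
  refine (lintegral_mono_ae hpt).trans ?_
  rw [lintegral_lintegral_swap]
  · refine lintegral_mono fun x => ?_
    simp only [k]
    have hm : Measurable fun t => ‖V (-(δ * x) + t) - V t‖ₑ := by fun_prop
    rw [lintegral_const_mul _ (by fun_prop), lintegral_const_mul _ (by fun_prop)]
    gcongr
    have h3 := Real.smul_map_volume_mul_left hδ.ne'
    conv_rhs => rw [← h3]
    rw [lintegral_smul_measure, lintegral_map hm (by fun_prop), abs_of_pos hδ, smul_eq_mul]
  · have hc : Continuous fun p : ℝ × ℝ => V (-(δ * p.2) + δ * p.1) - V (δ * p.1) := by fun_prop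
    exact hf.aestronglyMeasurable.comp_snd.enorm.mul (hc.enorm.measurable.const_mul _).aemeasurable

theorem tendsto_lintegral_enorm_translate (V : SchwartzMap ℝ ℂ) {f : ℝ → ℂ}
    (hf : Integrable f) :
    Tendsto (fun δ : ℝ => ∫⁻ x, ‖f x‖ₑ * ∫⁻ t, ‖V (-(δ * x) + t) - V t‖ₑ) (𝓝 0) (𝓝 0) := by
  have hV := V.integrable (μ := volume)
  have hVc := V.continuous
  have hN : Measurable fun h : ℝ => ∫⁻ t, ‖V (h + t) - V t‖ₑ := by
    refine Measurable.lintegral_prod_right' (f := fun p : ℝ × ℝ => ‖V (p.1 + p.2) - V p.2‖ₑ) ?_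
    fun_prop
  have hbd : ∀ h : ℝ, ∫⁻ t, ‖V (h + t) - V t‖ₑ ≤ 2 * ∫⁻ t, ‖V t‖ₑ := by
    intro h
    calc ∫⁻ t, ‖V (h + t) - V t‖ₑ ≤ ∫⁻ t, (‖V (h + t)‖ₑ + ‖V t‖ₑ) :=
          lintegral_mono fun t => enorm_sub_le
      _ = 2 * ∫⁻ t, ‖V t‖ₑ := by
          rw [lintegral_add_left (Continuous.measurable (by fun_prop)), lintegral_add_left_eq_self (fun t => ‖V t‖ₑ) h,
            two_mul]
  have h0 : (0 : ℝ≥0∞) = ∫⁻ x : ℝ, 0 := by simp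
  rw [h0]
  refine tendsto_lintegral_filter_of_dominated_convergence'
    (fun x => ‖f x‖ₑ * (2 * ∫⁻ t, ‖V t‖ₑ)) ?_ ?_ ?_ ?_
  · refine Eventually.of_forall fun δ => ?_
    exact hf.aestronglyMeasurable.enorm.mul
      (hN.comp (g := fun x : ℝ => ∫⁻ t, ‖V (x + t) - V t‖ₑ) (f := fun x => -(δ * x))
        (by fun_prop)).aemeasurable
  · exact Eventually.of_forall fun δ => Eventually.of_forall fun x => by
      gcongr; exact hbd _
  · rw [lintegral_mul_const' _ _ (ENNReal.mul_ne_top ENNReal.ofNat_ne_top hV.2.ne)]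
    exact ENNReal.mul_ne_top hf.2.ne (ENNReal.mul_ne_top ENNReal.ofNat_ne_top hV.2.ne)
  · refine Eventually.of_forall fun x => ?_
    have h1 : Tendsto (fun δ : ℝ => -(δ * x)) (𝓝 0) (𝓝 0) := by
      have : Continuous fun δ : ℝ => -(δ * x) := by fun_prop
      simpa using this.tendsto 0
    have h2 := (tendsto_lintegral_enorm_comp_add_sub hV).comp h1
    have h3 := ENNReal.Tendsto.const_mul (a := ‖f x‖ₑ) h2 (Or.inr enorm_ne_top)
    simpa using h3

variable {X : Type*} [NormedAddCommGroup X] [NormedSpace ℂ X] [CompleteSpace X]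

/-- With `c = 𝓕 f ω`, and `W` having transform `1` within `δ` of `ω`, the function `r = c W - f ⋆ W`
has `L¹` norm below `‖c‖` for small `δ`. For `h` with spectrum in that band and `ψ = h ⋆ φ`, the
relation `f ⋆ φ = 0` yields `c ψ = r ⋆ ψ`, and comparing sup norms forces `ψ = 0`. -/
theorem exists_annihilating_radius {f : ℝ → ℂ} (hf : Integrable f) {φ : ℝ → X}
    (hφ : AEStronglyMeasurable φ) {C : ℝ} (hC : ∀ᵐ x, ‖φ x‖ ≤ C)
    (h0 : convolution f φ (ContinuousLinearMap.lsmul ℂ ℂ) volume = 0) {ω : ℝ}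
    (hω : 𝓕 f ω ≠ 0) :
    ∃ δ > 0, ∀ h : ℝ → ℂ, Integrable h → (∀ s, δ < |s - ω| → 𝓕 h s = 0) →
      convolution h φ (ContinuousLinearMap.lsmul ℂ ℂ) volume = 0 := by
  obtain ⟨q, hq, hqc, hq1, -⟩ := exists_complex_bump 0 one_pos
  obtain ⟨V, hVq⟩ := exists_integrable_fourier_eq hq hqc
  have hpos : (0 : ℝ≥0∞) < ‖𝓕 f ω‖ₑ := by simpa [enorm_pos] using hω
  have hev := ((tendsto_lintegral_enorm_translate V hf).mono_left
    (nhdsWithin_le_nhds (s := Ioi (0 : ℝ)))).eventually (gt_mem_nhds hpos)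
  obtain ⟨δ, hδl, hδ⟩ := (hev.and self_mem_nhdsWithin).exists
  have hδ : 0 < δ := hδ
  refine ⟨δ, hδ, fun h hh hsupp => ?_⟩
  set W := modDilate V ω δ with hWdef
  have hW : Integrable W := integrable_modDilate V.integrable ω hδ
  set c := 𝓕 f ω with hc
  have hfW : Integrable (f ⋆[ContinuousLinearMap.mul ℂ ℂ] W) := hf.integrable_convolution _ hW
  set r : ℝ → ℂ := fun t => c * W t - (f ⋆[ContinuousLinearMap.mul ℂ ℂ] W) t with hr
  have hri : Integrable r := (hW.const_mul c).sub hfW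
  have hrn : ∫ t, ‖r t‖ < ‖c‖ := by
    have h1 := (lintegral_enorm_modDilate_sub_le V hf ω hδ).trans_lt hδl
    rw [integral_norm_eq_lintegral_enorm hri.aestronglyMeasurable]
    have := ENNReal.toReal_strict_mono enorm_ne_top h1
    simpa using this
  set ψ : ℝ → X := h ⋆[ContinuousLinearMap.lsmul ℂ ℂ] φ with hψ
  -- `W` acts as an identity on `h`: at each frequency either `𝓕 W = 1` or `𝓕 h = 0`.
  have hae : r ⋆[ContinuousLinearMap.mul ℂ ℂ] h =ᵐ[volume]
      fun t => c * h t + -(h ⋆[ContinuousLinearMap.mul ℂ ℂ] f) t := by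
    have hhf : Integrable (h ⋆[ContinuousLinearMap.mul ℂ ℂ] f) := hh.integrable_convolution _ hf
    refine ae_eq_of_fourier_eq (hri.integrable_convolution _ hh)
      ((hh.const_mul c).add hhf.neg) ?_
    have e1 : 𝓕 r = fun s => c * 𝓕 W s - 𝓕 f s * 𝓕 W s := by
      have e : r = c • W + (-1 : ℂ) • (f ⋆[ContinuousLinearMap.mul ℂ ℂ] W) := by
        ext t; simp [hr, sub_eq_add_neg]
      rw [e, fourier_add_of_integrable (hW.smul c) (hfW.smul _)]
      ext s
      rw [Pi.add_apply, fourier_const_smul, fourier_const_smul, Real.fourier_mul_convolution_eq hf hW]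
      simp [sub_eq_add_neg]
    have e3 : 𝓕 (fun t => c * h t + -(h ⋆[ContinuousLinearMap.mul ℂ ℂ] f) t) =
        fun s => c * 𝓕 h s - 𝓕 h s * 𝓕 f s := by
      have e : (fun t => c * h t + -(h ⋆[ContinuousLinearMap.mul ℂ ℂ] f) t) =
          c • h + (-1 : ℂ) • (h ⋆[ContinuousLinearMap.mul ℂ ℂ] f) := by
        ext t; simp
      rw [e, fourier_add_of_integrable (hh.smul c) (hhf.smul _)]
      ext s
      rw [Pi.add_apply, fourier_const_smul, fourier_const_smul, Real.fourier_mul_convolution_eq hh hf]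
      simp [sub_eq_add_neg]
    rw [e3]
    ext s
    rw [Real.fourier_mul_convolution_eq hri hh, e1]
    dsimp only
    rcases le_or_gt (|s - ω|) δ with hs | hs
    · have : 𝓕 W s = 1 := by
        rw [hWdef, fourier_modDilate _ _ hδ, hVq]
        refine hq1 _ ?_
        rw [sub_zero, abs_div, abs_of_pos hδ]
        exact (div_le_one hδ).2 hs
      rw [this]; ring
    · rw [hsupp s hs]; ring
  have hψb := norm_convolution_le_of_bdd (ContinuousLinearMap.lsmul ℂ ℂ) hh hC
  have hcψ : ∀ x, c • ψ x = (r ⋆[ContinuousLinearMap.lsmul ℂ ℂ] ψ) x := by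
    intro x
    have a1 := convolution_assoc_of_bdd (ContinuousLinearMap.mul ℂ ℂ)
      (ContinuousLinearMap.lsmul ℂ ℂ) (ContinuousLinearMap.lsmul ℂ ℂ)
      (ContinuousLinearMap.lsmul ℂ ℂ : ℂ →L[ℂ] X →L[ℂ] X)
      (fun x y z => mul_smul x y z) hri hh hφ hC
    have a2 := convolution_assoc_of_bdd (ContinuousLinearMap.mul ℂ ℂ)
      (ContinuousLinearMap.lsmul ℂ ℂ) (ContinuousLinearMap.lsmul ℂ ℂ)
      (ContinuousLinearMap.lsmul ℂ ℂ : ℂ →L[ℂ] X →L[ℂ] X)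
      (fun x y z => mul_smul x y z) hh hf hφ hC
    rw [h0, convolution_zero] at a2
    rw [← a1, convolution_congr_left _ φ hae]
    have hhf : Integrable (h ⋆[ContinuousLinearMap.mul ℂ ℂ] f) := hh.integrable_convolution _ hf
    have i1 := convolutionExistsAt_of_integrable_of_bdd
      (ContinuousLinearMap.lsmul ℂ ℂ : ℂ →L[ℂ] X →L[ℂ] X) hh hφ hC x
    have i2 := convolutionExistsAt_of_integrable_of_bdd
      (ContinuousLinearMap.lsmul ℂ ℂ : ℂ →L[ℂ] X →L[ℂ] X) hhf hφ hC x
    have a3 := congrFun a2 x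
    rw [convolution_def] at a3 ⊢
    simp only [ContinuousLinearMap.lsmul_apply, add_smul, neg_smul, mul_smul]
    rw [integral_add, integral_neg, integral_smul]
    · simp only [ContinuousLinearMap.lsmul_apply] at a3
      rw [a3]
      simp only [Pi.zero_apply, neg_zero, add_zero]
      rfl
    · exact Integrable.smul c i1
    · exact i2.neg
  have hbdd : BddAbove (range fun x => ‖ψ x‖) := ⟨_, by rintro _ ⟨x, rfl⟩; exact hψb x⟩
  set M := ⨆ x, ‖ψ x‖ with hM
  have hψM : ∀ x, ‖ψ x‖ ≤ M := fun x => le_ciSup hbdd x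
  have hM0 : 0 ≤ M := (norm_nonneg _).trans (hψM 0)
  have hr0 : 0 ≤ ∫ t, ‖r t‖ := integral_nonneg fun _ => norm_nonneg _
  have hcpos : 0 < ‖c‖ := norm_pos_iff.2 hω
  have hle : M ≤ (∫ t, ‖r t‖) * M / ‖c‖ := by
    refine ciSup_le fun x => ?_
    rw [le_div_iff₀ hcpos, mul_comm, ← norm_smul, hcψ x]
    refine (norm_convolution_le_of_bdd _ hri (Eventually.of_forall hψM) x).trans ?_
    refine mul_le_mul_of_nonneg_right ?_ hM0
    exact mul_le_of_le_one_left hr0 ContinuousLinearMap.opNorm_lsmul_le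
  have hM00 : M = 0 := by
    by_contra hne
    have hMpos : 0 < M := lt_of_le_of_ne hM0 (Ne.symm hne)
    rw [le_div_iff₀ hcpos, mul_comm] at hle
    exact absurd (le_of_mul_le_mul_right hle hMpos) (not_le.2 hrn)
  ext x
  have := hψM x
  rw [hM00] at this
  simpa using this

/-- A compact set on which the ideal of `L¹`-functions annihilating `φ` has no common zero of
Fourier transforms carries a smooth cutoff function belonging to that ideal. -/
theorem exists_annihilating_cutoff {φ : ℝ → X}
    (hφ : AEStronglyMeasurable φ) {C : ℝ} (hC : ∀ᵐ x, ‖φ x‖ ≤ C) {K : Set ℝ} (hK : IsCompact K)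
    (h : ∀ ω ∈ K, ∃ f : ℝ → ℂ, Integrable f ∧
      convolution f φ (ContinuousLinearMap.lsmul ℂ ℂ) volume = 0 ∧ 𝓕 f ω ≠ 0) :
    ∃ k : ℝ → ℂ, Integrable k ∧ convolution k φ (ContinuousLinearMap.lsmul ℂ ℂ) volume = 0 ∧
      ContDiff ℝ (⊤ : ℕ∞) (𝓕 k) ∧ HasCompactSupport (𝓕 k) ∧ ∀ᶠ s in 𝓝ˢ K, 𝓕 k s = 1 := by
  refine hK.induction_on (p := fun S => ∃ k : ℝ → ℂ, Integrable k ∧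
    convolution k φ (ContinuousLinearMap.lsmul ℂ ℂ) volume = 0 ∧
      ContDiff ℝ (⊤ : ℕ∞) (𝓕 k) ∧ HasCompactSupport (𝓕 k) ∧ ∀ᶠ s in 𝓝ˢ S, 𝓕 k s = 1)
    ?_ ?_ ?_ ?_
  · have : 𝓕 (0 : ℝ → ℂ) = 0 := by ext s; simp [Real.fourier_real_eq]
    refine ⟨0, integrable_zero _ _ _, zero_convolution, ?_, ?_, by simp⟩
    · rw [this]; exact contDiff_const
    · rw [this]; exact HasCompactSupport.zero
  · rintro s t hst ⟨k, h1, h2, h3, h4, h5⟩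
    exact ⟨k, h1, h2, h3, h4, h5.filter_mono (nhdsSet_mono hst)⟩
  · rintro s t ⟨k₁, i₁, a₁, d₁, c₁, e₁⟩ ⟨k₂, i₂, a₂, d₂, c₂, e₂⟩
    have hi : Integrable (k₁ ⋆[ContinuousLinearMap.mul ℂ ℂ] k₂) := i₁.integrable_convolution _ i₂
    -- The combination is `1 - (1 - 𝓕 k₁)(1 - 𝓕 k₂)`, which equals `1` wherever either cutoff does;
    -- the annihilating functions form an ideal, so it stays among them.
    have hF : 𝓕 (k₁ + k₂ + -(k₁ ⋆[ContinuousLinearMap.mul ℂ ℂ] k₂)) =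
        fun s => 𝓕 k₁ s + 𝓕 k₂ s - 𝓕 k₁ s * 𝓕 k₂ s := by
      rw [fourier_add_of_integrable (i₁.add i₂) hi.neg, fourier_add_of_integrable i₁ i₂]
      ext s
      have e2 : 𝓕 (-(k₁ ⋆[ContinuousLinearMap.mul ℂ ℂ] k₂)) s =
          -𝓕 (k₁ ⋆[ContinuousLinearMap.mul ℂ ℂ] k₂) s := by
        simp [Real.fourier_real_eq, integral_neg]
      rw [Pi.add_apply, Pi.add_apply, e2, Real.fourier_mul_convolution_eq i₁ i₂]
      ring
    refine ⟨k₁ + k₂ + -(k₁ ⋆[ContinuousLinearMap.mul ℂ ℂ] k₂), (i₁.add i₂).add hi.neg,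
      ?_, ?_, ?_, ?_⟩
    · have a3 := convolution_assoc_of_bdd (ContinuousLinearMap.mul ℂ ℂ)
        (ContinuousLinearMap.lsmul ℂ ℂ) (ContinuousLinearMap.lsmul ℂ ℂ)
        (ContinuousLinearMap.lsmul ℂ ℂ : ℂ →L[ℂ] X →L[ℂ] X)
        (fun x y z => mul_smul x y z) i₁ i₂ hφ hC
      rw [a₂, convolution_zero] at a3
      ext x
      have j := fun {g : ℝ → ℂ} (hg : Integrable g) =>
        convolutionExistsAt_of_integrable_of_bdd
          (ContinuousLinearMap.lsmul ℂ ℂ : ℂ →L[ℂ] X →L[ℂ] X) hg hφ hC x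
      rw [ConvolutionExistsAt.add_distrib (j (i₁.add i₂)) (j hi.neg),
        ConvolutionExistsAt.add_distrib (j i₁) (j i₂), a₁, a₂]
      have : (-(k₁ ⋆[ContinuousLinearMap.mul ℂ ℂ] k₂) ⋆[ContinuousLinearMap.lsmul ℂ ℂ] φ) x =
          -((k₁ ⋆[ContinuousLinearMap.mul ℂ ℂ] k₂) ⋆[ContinuousLinearMap.lsmul ℂ ℂ] φ) x := by
        simp [convolution_def, integral_neg]
      rw [this, a3]
      simp
    · rw [hF]; exact (d₁.add d₂).sub (d₁.mul d₂)
    · rw [hF]; exact (c₁.add c₂).sub (c₁.mul_right)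
    · rw [hF, nhdsSet_union]
      refine eventually_sup.2 ⟨?_, ?_⟩
      · filter_upwards [e₁] with x hx
        rw [hx]; ring
      · filter_upwards [e₂] with x hx
        rw [hx]; ring
  · intro ω hω
    obtain ⟨f, hf, hfφ, hfω⟩ := h ω hω
    obtain ⟨δ, hδ, hann⟩ := exists_annihilating_radius hf hφ hC hfφ hfω
    obtain ⟨q, hq, hqc, hq1, hq0⟩ := exists_complex_bump ω (half_pos hδ)
    obtain ⟨V, hVq⟩ := exists_integrable_fourier_eq hq hqc
    refine ⟨Metric.ball ω (δ / 2), mem_nhdsWithin_of_mem_nhds (Metric.ball_mem_nhds ω (half_pos hδ)),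
      V, V.integrable, hann V V.integrable fun s hs => ?_, ?_, ?_, ?_⟩
    · rw [hVq]; exact hq0 s (by linarith)
    · rwa [hVq]
    · rwa [hVq]
    · rw [Metric.isOpen_ball.nhdsSet_eq, hVq]
      refine eventually_principal.2 fun s hs => hq1 s ?_
      rw [Metric.mem_ball, Real.dist_eq] at hs
      exact hs.le

end WienerLocalization

/-! ### Resolvent identity, openness of the resolvent set, derivatives along the imaginary axis. -/

section Resolvent

variable {X : Type*} [NormedAddCommGroup X] [NormedSpace ℂ X]

theorem IsResolventAt.resolvent_identity {A : X →ₗ.[ℂ] X} {z w : ℂ} {R S : X →L[ℂ] X}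
    (hR : IsResolventAt A z R) (hS : IsResolventAt A w S) :
    S = R + (z - w) • (R * S) := by
  ext x
  obtain ⟨h, hx⟩ := hS.1 x
  have h1 := hR.2 ⟨S x, h⟩
  have h2 : z • S x - A ⟨S x, h⟩ = x + (z - w) • S x := by
    rw [sub_smul]; nth_rewrite 3 [← hx]; abel
  simp only at h1
  rw [h2, map_add, map_smul] at h1
  simpa using h1.symm

/-- This inverts the factorization `w - A = (1 + (w - z) R)(z - A)` on `D(A)`; `R` commutes with the
inverse of the first factor. -/
theorem IsResolventAt.mul_inverse {A : X →ₗ.[ℂ] X} {z w : ℂ} {R : X →L[ℂ] X}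
    (hR : IsResolventAt A z R) (u : (X →L[ℂ] X)ˣ) (hu : (u : X →L[ℂ] X) = 1 + (w - z) • R) :
    IsResolventAt A w (R * ↑u⁻¹) := by
  have hcomm : Commute R (↑u⁻¹ : X →L[ℂ] X) := by
    refine Commute.units_inv_right ?_
    rw [hu]
    exact (Commute.one_right R).add_right ((Commute.refl R).smul_right _)
  constructor
  · intro x
    obtain ⟨h, hx⟩ := hR.1 ((↑u⁻¹ : X →L[ℂ] X) x)
    refine ⟨h, ?_⟩
    have h1 : (u : X →L[ℂ] X) ((↑u⁻¹ : X →L[ℂ] X) x) = x := by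
      rw [← mul_apply_eq_comp, Units.mul_inv]; rfl
    rw [hu] at h1
    have h2 : (↑u⁻¹ : X →L[ℂ] X) x + (w - z) • R ((↑u⁻¹ : X →L[ℂ] X) x) = x := by simpa using h1
    calc w • R ((↑u⁻¹ : X →L[ℂ] X) x) - A ⟨R ((↑u⁻¹ : X →L[ℂ] X) x), h⟩
        = (z • R ((↑u⁻¹ : X →L[ℂ] X) x) - A ⟨R ((↑u⁻¹ : X →L[ℂ] X) x), h⟩) +
            (w - z) • R ((↑u⁻¹ : X →L[ℂ] X) x) := by rw [sub_smul]; abel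
      _ = x := by rw [hx, h2]
  · intro x
    have h1 := hR.2 x
    have h2 : (R * ↑u⁻¹) (w • (x : X) - A x) = (↑u⁻¹ * (u : X →L[ℂ] X)) (x : X) := by
      rw [hcomm.eq, hu, mul_apply_eq_comp, mul_apply_eq_comp]
      congr 1
      have e : w • (x : X) - A x = (z • (x : X) - A x) + (w - z) • (x : X) := by
        rw [sub_smul]; abel
      rw [e, map_add, h1]
      simp
    rw [h2, Units.inv_mul]
    rfl

theorem eventually_opResolvent_eq [CompleteSpace X] {A : X →ₗ.[ℂ] X} {z : ℂ}
    (hz : z ∉ opSpectrum A) : ∀ᶠ w in 𝓝 z, w ∉ opSpectrum A ∧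
      opResolvent A w = opResolvent A z * Ring.inverse (1 + (w - z) • opResolvent A z) := by
  have hR := opResolvent_spec hz
  have hc : Continuous fun w : ℂ => 1 + (w - z) • opResolvent A z := by fun_prop
  have : ∀ᶠ w in 𝓝 z, IsUnit (1 + (w - z) • opResolvent A z) := by
    refine hc.continuousAt.eventually (Units.isOpen.mem_nhds ?_)
    simp
  filter_upwards [this] with w hw
  obtain ⟨u, hu⟩ := hw
  have h := hR.mul_inverse u hu
  have hw' : w ∉ opSpectrum A := not_not.2 ⟨_, h⟩
  refine ⟨hw', ?_⟩
  rw [← hu, Ring.inverse_unit]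
  exact (opResolvent_spec hw').unique h

theorem isClosed_opSpectrum [CompleteSpace X] (A : X →ₗ.[ℂ] X) : IsClosed (opSpectrum A) := by
  rw [← isOpen_compl_iff, isOpen_iff_mem_nhds]
  intro z hz
  filter_upwards [eventually_opResolvent_eq hz] with w hw using hw.1

theorem contDiffAt_opResolvent [CompleteSpace X] {A : X →ₗ.[ℂ] X} {z : ℂ}
    (hz : z ∉ opSpectrum A) {n : WithTop ℕ∞} : ContDiffAt ℂ n (opResolvent A) z := by
  have h : ContDiffAt ℂ n
      (fun w => opResolvent A z * Ring.inverse (1 + (w - z) • opResolvent A z)) z := by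
    refine contDiffAt_const.mul ?_
    refine ContDiffAt.comp z (g := Ring.inverse) ?_ ?_
    · have := contDiffAt_ringInverse (n := n) ℂ (1 : (X →L[ℂ] X)ˣ)
      simpa using this
    · fun_prop
  exact h.congr_of_eventuallyEq ((eventually_opResolvent_eq hz).mono fun w hw => hw.2)

theorem hasDerivAt_opResolvent [CompleteSpace X] {A : X →ₗ.[ℂ] X} {z : ℂ}
    (hz : z ∉ opSpectrum A) :
    HasDerivAt (opResolvent A) (-(opResolvent A z * opResolvent A z)) z := by
  have h0 : HasDerivAt (fun w : ℂ => 1 + (w - z) • opResolvent A z) (opResolvent A z) z := by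
    have := (((hasDerivAt_id z).sub_const z).smul_const (opResolvent A z)).const_add 1
    simpa using this
  have h1 := hasFDerivAt_ringInverse (𝕜 := ℂ) (1 : (X →L[ℂ] X)ˣ)
  have h2 : HasFDerivAt (𝕜 := ℂ) (Ring.inverse : (X →L[ℂ] X) → _)
      (-ContinuousLinearMap.mulLeftRight ℂ (X →L[ℂ] X) 1 1)
      (1 + (z - z) • opResolvent A z) := by simpa using h1
  have h3 := (h2.comp_hasDerivAt z h0).const_mul (opResolvent A z)
  refine (h3.congr_of_eventuallyEq
    ((eventually_opResolvent_eq hz).mono fun w hw => hw.2)).congr_deriv ?_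
  simp

/-- The resolvent along the imaginary axis, in the frequency normalization of `𝓕`. -/
noncomputable def axisResolvent (A : X →ₗ.[ℂ] X) (s : ℝ) : X →L[ℂ] X :=
  opResolvent A (Complex.I * ((2 * Real.pi * s : ℝ) : ℂ))

theorem contDiffAt_axisResolvent [CompleteSpace X] {A : X →ₗ.[ℂ] X} {s : ℝ}
    (hs : Complex.I * ((2 * Real.pi * s : ℝ) : ℂ) ∉ opSpectrum A) {n : WithTop ℕ∞} :
    ContDiffAt ℝ n (axisResolvent A) s := by
  refine ContDiffAt.comp s (g := opResolvent A)
    ((contDiffAt_opResolvent hs).restrict_scalars ℝ) ?_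
  have : ContDiff ℝ n fun s : ℝ => Complex.I * ((2 * Real.pi * s : ℝ) : ℂ) :=
    contDiff_const.mul (Complex.ofRealCLM.contDiff.comp (contDiff_const.mul contDiff_id))
  exact this.contDiffAt

/-- Differentiation raises the power of the resolvent by one, so each derivative gains a further
factor of decay. -/
theorem hasDerivAt_axisResolvent_pow [CompleteSpace X] {A : X →ₗ.[ℂ] X} {s : ℝ}
    (hs : Complex.I * ((2 * Real.pi * s : ℝ) : ℂ) ∉ opSpectrum A) (n : ℕ) :
    HasDerivAt (fun s => axisResolvent A s ^ (n + 1))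
      ((-(2 * Real.pi * Complex.I * (n + 1))) • axisResolvent A s ^ (n + 2)) s := by
  have h0 : HasDerivAt (fun s : ℝ => Complex.I * ((2 * Real.pi * s : ℝ) : ℂ))
      (Complex.I * (2 * Real.pi)) s := by
    have h1 : HasDerivAt (fun s : ℝ => 2 * Real.pi * s) (2 * Real.pi) s := by
      simpa using (hasDerivAt_id s).const_mul (2 * Real.pi)
    simpa using h1.ofReal_comp.const_mul Complex.I
  have h1 : HasDerivAt (axisResolvent A)
      ((-(2 * Real.pi * Complex.I)) • axisResolvent A s ^ 2) s := by
    have := (hasDerivAt_opResolvent hs).scomp s h0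
    refine this.congr_deriv ?_
    simp only [axisResolvent, pow_two, smul_neg, neg_smul]
    congr 2
    ring
  induction n with
  | zero => simpa using h1
  | succ n ih =>
    have := ih.mul h1
    refine (this.congr_deriv ?_).congr_of_eventuallyEq ?_
    · simp only [smul_mul_assoc, mul_smul_comm, ← pow_succ, ← pow_add]
      rw [show n + 1 + 2 = n + 3 by ring, ← add_smul]
      congr 1
      push_cast
      ring
    · exact Eventually.of_forall fun t => pow_succ _ _

end Resolvent

/-! ### A Fourier criterion for integrable kernels. -/

section Kernel

variable {E : Type*} [NormedAddCommGroup E]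

theorem integrableOn_Ioi_of_rpow_bounds {f : ℝ → E} (hf : AEStronglyMeasurable f) {B r q : ℝ}
    (hr : -1 < r) (hq : q < -1) (h1 : ∀ t : ℝ, t ≠ 0 → ‖f t‖ ≤ B * |t| ^ r)
    (h2 : ∀ t : ℝ, t ≠ 0 → ‖f t‖ ≤ B * |t| ^ q) : IntegrableOn f (Ioi 0) := by
  rw [← Ioc_union_Ioi_eq_Ioi (zero_le_one' ℝ)]
  refine IntegrableOn.union ?_ ?_
  · have h : IntegrableOn (fun t : ℝ => B * t ^ r) (Ioc 0 1) :=
      ((intervalIntegrable_iff_integrableOn_Ioc_of_le zero_le_one).1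
        (intervalIntegral.intervalIntegrable_rpow' hr)).const_mul B
    refine Integrable.mono' h hf.restrict ?_
    filter_upwards [ae_restrict_mem measurableSet_Ioc] with t ht
    simpa [abs_of_pos ht.1] using h1 t ht.1.ne'
  · have h : IntegrableOn (fun t : ℝ => B * t ^ q) (Ioi 1) :=
      (integrableOn_Ioi_rpow_of_lt hq zero_lt_one).const_mul B
    refine Integrable.mono' h hf.restrict ?_
    filter_upwards [ae_restrict_mem measurableSet_Ioi] with t ht
    have ht : (0 : ℝ) < t := zero_lt_one.trans ht
    simpa [abs_of_pos ht] using h2 t ht.ne'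

theorem integrable_of_rpow_bounds {f : ℝ → E} (hf : AEStronglyMeasurable f) {B r q : ℝ}
    (hr : -1 < r) (hq : q < -1) (h1 : ∀ t : ℝ, t ≠ 0 → ‖f t‖ ≤ B * |t| ^ r)
    (h2 : ∀ t : ℝ, t ≠ 0 → ‖f t‖ ≤ B * |t| ^ q) : Integrable f := by
  have hmp := Measure.measurePreserving_neg (volume : Measure ℝ)
  have hneg : IntegrableOn (fun t => f (-t)) (Ioi 0) := by
    refine integrableOn_Ioi_of_rpow_bounds (B := B) (hf.comp_measurePreserving hmp) hr hq
      (fun t ht => ?_) (fun t ht => ?_)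
    · simpa using h1 (-t) (neg_ne_zero.2 ht)
    · simpa using h2 (-t) (neg_ne_zero.2 ht)
  have hIio : IntegrableOn f (Iio 0) := by
    have := (hmp.integrableOn_comp_preimage (MeasurableEquiv.neg ℝ).measurableEmbedding
      (f := f) (s := Iio 0)).1
    refine this ?_
    simpa [Function.comp_def] using! hneg
  rw [← integrableOn_univ, ← Iic_union_Ioi (a := (0 : ℝ))]
  exact ((integrableOn_Iic_iff_integrableOn_Iio (by simp)).2 hIio).union
    (integrableOn_Ioi_of_rpow_bounds hf hr hq h1 h2)

/-- Interpolation between the Lipschitz bound `2π|x|` and the trivial bound `2`. -/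
theorem norm_fourierChar_sub_one_le_rpow (x : ℝ) {ε : ℝ} (h0 : 0 < ε) (h1 : ε ≤ 1) :
    ‖(Real.fourierChar x : ℂ) - 1‖ ≤ 2 * (2 * Real.pi * |x|) ^ ε := by
  have e : ‖(Real.fourierChar x : ℂ) - 1‖ ≤ 2 * Real.pi * |x| := by
    rw [Real.fourierChar_apply]
    have := Real.norm_exp_I_mul_ofReal_sub_one_le (x := 2 * Real.pi * x)
    rw [mul_comm Complex.I] at this
    refine this.trans_eq ?_
    rw [Real.norm_eq_abs, abs_mul, abs_of_pos Real.two_pi_pos]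
  have hx : 0 ≤ 2 * Real.pi * |x| := by positivity
  rcases le_total (2 * Real.pi * |x|) 1 with h | h
  · refine e.trans ?_
    have := Real.rpow_le_rpow_of_exponent_ge' hx h h0.le h1
    rw [Real.rpow_one] at this
    have h3 : 0 ≤ (2 * Real.pi * |x|) ^ ε := by positivity
    linarith
  · have h2 : 1 ≤ (2 * Real.pi * |x|) ^ ε := Real.one_le_rpow h h0.le
    have h3 : ‖(Real.fourierChar x : ℂ) - 1‖ ≤ 2 := by
      refine (norm_sub_le _ _).trans ?_
      rw [Circle.norm_coe, norm_one]; norm_num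
    linarith

theorem norm_fourier_le_integral_norm [NormedSpace ℂ E] (f : ℝ → E) (t : ℝ) : ‖𝓕 f t‖ ≤ ∫ s, ‖f s‖ := by
  rw [Real.fourier_real_eq]
  refine (norm_integral_le_integral_norm _).trans_eq ?_
  congr 1; ext s; rw [Circle.norm_smul]

theorem integrable_of_continuous_of_decay {f : ℝ → E} (hf : Continuous f) {p C : ℝ} (hp : 1 < p)
    (h : ∀ s, ‖f s‖ ≤ C * (1 + |s|) ^ (-p)) : Integrable f := by
  have := (integrable_one_add_norm (E := ℝ) (μ := volume) (r := p) (by simpa using hp)).const_mul C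
  exact this.mono' hf.aestronglyMeasurable (Eventually.of_forall h)

variable [NormedSpace ℂ E]

/-- The Fourier transform of a function with vanishing integral and decay of order `p > 1` is
Hölder continuous at `0`. -/
theorem exists_norm_fourier_le_rpow {f : ℝ → E} (hf : Continuous f) {p C : ℝ} (hp : 1 < p)
    (h : ∀ s, ‖f s‖ ≤ C * (1 + |s|) ^ (-p)) (h0 : ∫ s, f s = 0) :
    ∃ ε : ℝ, 0 < ε ∧ ∃ B : ℝ, ∀ t, ‖𝓕 f t‖ ≤ B * |t| ^ ε := by
  -- The exponent `ε` is small enough that the weight of order `p - ε` is still integrable.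
  obtain ⟨ε, hε, hε1, hεp⟩ : ∃ ε : ℝ, 0 < ε ∧ ε ≤ 1 ∧ 1 < p - ε :=
    ⟨min 1 ((p - 1) / 2), lt_min one_pos (by linarith), min_le_left _ _, by
      have := min_le_right 1 ((p - 1) / 2); linarith⟩
  have hC : 0 ≤ C := by simpa using (norm_nonneg _).trans (h 0)
  have hi := integrable_of_continuous_of_decay hf hp h
  refine ⟨ε, hε, ∫ s : ℝ, 2 * (2 * Real.pi) ^ ε * (C * (1 + |s|) ^ (-(p - ε))), fun t => ?_⟩
  -- The vanishing integral allows `1` to be subtracted from the character.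
  have hF : 𝓕 f t = ∫ s, ((Real.fourierChar (-(s * t)) : ℂ) - 1) • f s := by
    have h1 : Integrable fun s => (Real.fourierChar (-(s * t)) : ℂ) • f s := by
      have := (Real.fourierIntegral_convergent_iff (μ := volume) (f := f) t).2 hi
      simpa [mul_comm, Circle.smul_def] using this
    simp_rw [sub_smul, one_smul]
    rw [integral_sub h1 hi, h0, sub_zero, Real.fourier_real_eq]
    rfl
  rw [hF, ← integral_mul_const]
  have hi2 := (((integrable_one_add_norm (E := ℝ) (μ := volume) (r := p - ε)
    (by simpa using hεp)).const_mul C).const_mul (2 * (2 * Real.pi) ^ ε)).mul_const (|t| ^ ε)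
  refine norm_integral_le_of_norm_le hi2 (Eventually.of_forall fun s => ?_)
  rw [norm_smul]
  have e1 := norm_fourierChar_sub_one_le_rpow (-(s * t)) hε hε1
  have hpos : 0 < 1 + |s| := by positivity
  have e2 : (2 * Real.pi * |(-(s * t))|) ^ ε ≤ (2 * Real.pi) ^ ε * (1 + |s|) ^ ε * |t| ^ ε := by
    rw [abs_neg, abs_mul, ← mul_assoc, Real.mul_rpow (by positivity) (by positivity),
      Real.mul_rpow (by positivity) (by positivity)]
    gcongr
    linarith
  calc ‖(Real.fourierChar (-(s * t)) : ℂ) - 1‖ * ‖f s‖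
      ≤ (2 * ((2 * Real.pi) ^ ε * (1 + |s|) ^ ε * |t| ^ ε)) * (C * (1 + |s|) ^ (-p)) := by
        gcongr
        · exact e1.trans (by gcongr)
        · exact h s
    _ = 2 * (2 * Real.pi) ^ ε * (C * (1 + |s|) ^ (-(p - ε))) * |t| ^ ε := by
        rw [show -(p - ε) = ε + -p by ring, Real.rpow_add hpos]; ring

/-- A `C³` function vanishing at infinity whose derivatives decay with order `p > 1` is the Fourier
transform of an integrable function. -/
theorem exists_integrable_fourier_eq_of_decay [CompleteSpace E] {m : ℝ → E} (hm : ContDiff ℝ 3 m)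
    (h0 : Tendsto m (cocompact ℝ) (𝓝 0)) {p C : ℝ} (hp : 1 < p)
    (hC : ∀ k : ℕ, 1 ≤ k → k ≤ 3 → ∀ s, ‖iteratedDeriv k m s‖ ≤ C * (1 + |s|) ^ (-p)) :
    ∃ G : ℝ → E, Integrable G ∧ 𝓕 G = m := by
  have hcont : ∀ k : ℕ, k ≤ 3 → Continuous (iteratedDeriv k m) := fun k hk =>
    hm.continuous_iteratedDeriv k (by exact_mod_cast hk)
  have hint : ∀ k : ℕ, 1 ≤ k → k ≤ 3 → Integrable (iteratedDeriv k m) := fun k h1 h3 =>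
    integrable_of_continuous_of_decay (hcont k h3) hp (hC k h1 h3)
  have hdiff : ∀ k : ℕ, k < 3 → Differentiable ℝ (iteratedDeriv k m) := fun k hk =>
    hm.differentiable_iteratedDeriv k (by exact_mod_cast hk)
  set m₁ := iteratedDeriv 1 m with hm₁
  have hm₁d : m₁ = deriv m := iteratedDeriv_one
  have hderiv : ∀ s, HasDerivAt m (m₁ s) s := fun s => by
    rw [hm₁d]
    have := hdiff 0 (by norm_num)
    rw [iteratedDeriv_zero] at this
    exact (this s).hasDerivAt
  have hi₁ : Integrable m₁ := hint 1 le_rfl (by norm_num)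
  have hF : ∀ k : ℕ, 1 ≤ k → k < 3 → ∀ t, 𝓕 (iteratedDeriv (k + 1) m) t =
      (2 * Real.pi * Complex.I * t) • 𝓕 (iteratedDeriv k m) t := by
    intro k h1 h3 t
    rw [iteratedDeriv_succ, Real.fourier_deriv (hint k h1 h3.le) (hdiff k h3)]
    rw [← iteratedDeriv_succ]
    exact hint (k + 1) (by omega) (by omega)
  have hzero : ∫ s, m₁ s = 0 := by
    have := integral_of_hasDerivAt_of_tendsto hderiv hi₁
      (h0.mono_left atBot_le_cocompact) (h0.mono_left atTop_le_cocompact)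
    simpa using this
  obtain ⟨ε, hε, B, hB⟩ := exists_norm_fourier_le_rpow (hcont 1 (by norm_num)) hp
    (hC 1 le_rfl (by norm_num)) hzero
  have hFc : Continuous (𝓕 m₁) :=
    VectorFourier.fourierIntegral_continuous Real.continuous_fourierChar continuous_inner hi₁
  -- Two more derivatives are integrable, which gives decay of order `t⁻²` for `𝓕 m₁`.
  obtain ⟨D, hD⟩ : ∃ D, ∀ t : ℝ, |t| ^ 2 * ‖𝓕 m₁ t‖ ≤ D := by
    refine ⟨∫ s, ‖iteratedDeriv 3 m s‖, fun t => ?_⟩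
    refine le_trans ?_ (norm_fourier_le_integral_norm (iteratedDeriv 3 m) t)
    rw [hF 2 (by norm_num) (by norm_num), hF 1 le_rfl (by norm_num), smul_smul, norm_smul]
    refine mul_le_mul_of_nonneg_right ?_ (norm_nonneg _)
    have : ‖2 * Real.pi * Complex.I * t * (2 * Real.pi * Complex.I * t)‖ =
        (2 * Real.pi) ^ 2 * |t| ^ 2 := by
      simp only [norm_mul, Complex.norm_ofNat, Complex.norm_real, Complex.norm_I, Real.norm_eq_abs,
        abs_of_pos Real.pi_pos]
      ring
    rw [this]
    have h4 : 1 ≤ (2 * Real.pi) ^ 2 := one_le_pow₀ (by linarith [Real.pi_gt_three])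
    nlinarith [sq_nonneg |t|]
  have hD2 : ∀ t : ℝ, t ≠ 0 → ‖𝓕 m₁ t‖ ≤ D * |t| ^ (-2 : ℝ) := by
    intro t ht
    have : 0 < |t| := abs_pos.2 ht
    rw [Real.rpow_neg this.le, Real.rpow_two, ← div_eq_mul_inv, le_div_iff₀ (by positivity),
      mul_comm]
    exact hD t
  have hm0 : 𝓕 m₁ 0 = 0 := by
    have := hB 0
    rw [abs_zero, Real.zero_rpow hε.ne', mul_zero] at this
    exact norm_le_zero_iff.1 this
  have hB' : ∀ t : ℝ, ‖𝓕 m₁ t‖ ≤ max B D * |t| ^ ε := fun t => (hB t).trans (by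
    gcongr; exact le_max_left _ _)
  have hD' : ∀ t : ℝ, t ≠ 0 → ‖𝓕 m₁ t‖ ≤ max B D * |t| ^ (-2 : ℝ) := fun t ht =>
    (hD2 t ht).trans (by gcongr; exact le_max_right _ _)
  have hFi : Integrable (𝓕 m₁) := integrable_of_rpow_bounds hFc.aestronglyMeasurable
    (B := max B D) (r := ε) (q := -2) (by linarith) (by norm_num) (fun t _ => hB' t) hD'
  -- Differentiating `𝓕 G` multiplies `G` by `-2πit`, so the candidate is `𝓕⁻ m₁` divided by that
  -- factor. The convention `0⁻¹ = 0` does no harm, as `𝓕 m₁ 0 = 0`.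
  set G : ℝ → E := fun t => ((-(2 * Real.pi * Complex.I))⁻¹ * (t : ℂ)⁻¹) • 𝓕 m₁ (-t) with hG
  have hGm : AEStronglyMeasurable G := by
    refine AEStronglyMeasurable.smul ?_ (hFc.comp continuous_neg).aestronglyMeasurable
    exact (measurable_const.mul (Complex.measurable_ofReal.inv)).aestronglyMeasurable
  have hc : ‖(-(2 * Real.pi * Complex.I))⁻¹‖ ≤ 1 := by
    rw [norm_inv, norm_neg]
    simp only [norm_mul, Complex.norm_ofNat, Complex.norm_real, Complex.norm_I, Real.norm_eq_abs,
      abs_of_pos Real.pi_pos, mul_one]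
    exact inv_le_one_of_one_le₀ (by linarith [Real.pi_gt_three])
  have hGn : ∀ t : ℝ, t ≠ 0 → ‖G t‖ ≤ |t| ^ (-1 : ℝ) * ‖𝓕 m₁ (-t)‖ := by
    intro t ht
    rw [hG]
    dsimp only
    rw [norm_smul, norm_mul, norm_inv (t : ℂ), Complex.norm_real, Real.norm_eq_abs,
      Real.rpow_neg_one]
    gcongr
    exact mul_le_of_le_one_left (by positivity) hc
  have hGi : Integrable G := by
    -- Dividing by `t` lowers both exponents by one: `ε - 1 > -1` near zero and `-3` at infinity.
    refine integrable_of_rpow_bounds hGm (B := max B D) (r := ε - 1) (q := -3) (by linarith)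
      (by norm_num) (fun t ht => ?_) (fun t ht => ?_)
    · have htp : 0 < |t| := abs_pos.2 ht
      refine (hGn t ht).trans ?_
      have := hB' (-t)
      rw [abs_neg] at this
      rw [sub_eq_add_neg, Real.rpow_add htp]
      calc |t| ^ (-1 : ℝ) * ‖𝓕 m₁ (-t)‖ ≤ |t| ^ (-1 : ℝ) * (max B D * |t| ^ ε) := by gcongr
        _ = _ := by ring
    · have htp : 0 < |t| := abs_pos.2 ht
      refine (hGn t ht).trans ?_
      have := hD' (-t) (neg_ne_zero.2 ht)
      rw [abs_neg] at this
      rw [show (-3 : ℝ) = -1 + -2 by norm_num, Real.rpow_add htp]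
      calc |t| ^ (-1 : ℝ) * ‖𝓕 m₁ (-t)‖ ≤ |t| ^ (-1 : ℝ) * (max B D * |t| ^ (-2 : ℝ)) := by gcongr
        _ = _ := by ring
  have hpi : (2 * Real.pi * Complex.I : ℂ) ≠ 0 := by simp [Real.pi_ne_zero]
  have htG : ∀ t : ℝ, (-2 * Real.pi * Complex.I * t) • G t = 𝓕⁻ m₁ t := by
    intro t
    rw [Real.fourierInv_eq_fourier_neg]
    rcases eq_or_ne t 0 with rfl | ht
    · simp [hm0]
    · simp only [hG]
      rw [smul_smul]
      have ht' : (t : ℂ) ≠ 0 := by exact_mod_cast ht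
      have : -2 * Real.pi * Complex.I * t * ((-(2 * Real.pi * Complex.I))⁻¹ * (t : ℂ)⁻¹) = 1 := by
        field_simp
      rw [this, one_smul]
  have hxG : Integrable fun t : ℝ => t • G t := by
    have h1 : Integrable fun t => (-(2 * Real.pi * Complex.I))⁻¹ • 𝓕 m₁ (-t) :=
      hFi.comp_neg.smul _
    refine h1.congr (Eventually.of_forall fun t => ?_)
    dsimp only
    rw [← Real.fourierInv_eq_fourier_neg, ← htG, smul_smul, ← Complex.coe_smul]
    congr 1
    field_simp
  have hder : ∀ s, HasDerivAt (𝓕 G) (m₁ s) s := by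
    intro s
    have h1 := Real.hasDerivAt_fourier hGi hxG s
    simp_rw [htG] at h1
    rwa [show (fun t => 𝓕⁻ m₁ t) = 𝓕⁻ m₁ from rfl,
      (hcont 1 (by norm_num)).fourier_fourierInv_eq hi₁ hFi] at h1
  refine ⟨G, hGi, ?_⟩
  have hsub : ∀ s, HasDerivAt (fun s => 𝓕 G s - m s) 0 s := fun s => by
    simpa [Pi.sub_def] using (hder s).sub (hderiv s)
  have hconst : ∀ s, 𝓕 G s - m s = 𝓕 G 0 - m 0 := fun s =>
    is_const_of_deriv_eq_zero (fun s => (hsub s).differentiableAt) (fun s => (hsub s).deriv) s 0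
  -- Riemann–Lebesgue for `𝓕 G` and the hypothesis on `m` make the constant difference vanish.
  have hlim : Tendsto (fun s => 𝓕 G s - m s) (cocompact ℝ) (𝓝 0) := by
    simpa using (Real.zero_at_infty_fourier G).sub h0
  have hz : 𝓕 G 0 - m 0 = 0 := by
    refine tendsto_nhds_unique (f := fun _ : ℝ => 𝓕 G 0 - m 0) (l := cocompact ℝ)
      tendsto_const_nhds (hlim.congr hconst)
  ext s
  exact sub_eq_zero.1 ((hconst s).trans hz)

end Kernel

/-! ### The cut-off resolvent as an `L¹` multiplier. -/

section Multiplier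

variable {X : Type*} [NormedAddCommGroup X] [NormedSpace ℂ X] [CompleteSpace X]

theorem exists_iteratedDeriv_eq_smul_axisResolvent_pow {A : X →ₗ.[ℂ] X} {m : ℝ → X →L[ℂ] X} {b : ℝ}
    (hσ : ∀ s : ℝ, b < |s| → Complex.I * ((2 * Real.pi * s : ℝ) : ℂ) ∉ opSpectrum A)
    (hm : ∀ s, b < |s| → m s = axisResolvent A s) (k : ℕ) :
    ∃ c : ℂ, ∀ s, b < |s| → iteratedDeriv k m s = c • axisResolvent A s ^ (k + 1) := by
  induction k with
  | zero => exact ⟨1, fun s hs => by simpa using hm s hs⟩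
  | succ k ih =>
    obtain ⟨c, hc⟩ := ih
    refine ⟨c * -(2 * Real.pi * Complex.I * (k + 1)), fun s hs => ?_⟩
    have hev : ∀ᶠ r in 𝓝 s, b < |r| := continuous_abs.continuousAt.eventually (lt_mem_nhds hs)
    have h := (hasDerivAt_axisResolvent_pow (hσ s hs) k).const_smul c
    rw [iteratedDeriv_succ, mul_smul]
    exact (h.congr_of_eventuallyEq (hev.mono fun r hr => hc r hr)).deriv

/-- Near a spectral point the factor `1 - χ` is identically zero, so the default value of
`opResolvent` there is irrelevant. -/
theorem contDiff_cutoff_smul_axisResolvent {A : X →ₗ.[ℂ] X} {χ : ℝ → ℂ}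
    (hχ : ContDiff ℝ (⊤ : ℕ∞) χ)
    (h1 : ∀ᶠ s in 𝓝ˢ {s : ℝ | Complex.I * ((2 * Real.pi * s : ℝ) : ℂ) ∈ opSpectrum A}, χ s = 1) :
    ContDiff ℝ 3 fun s => (1 - χ s) • axisResolvent A s := by
  rw [contDiff_iff_contDiffAt]
  intro s
  by_cases hs : Complex.I * ((2 * Real.pi * s : ℝ) : ℂ) ∈ opSpectrum A
  · have : ∀ᶠ r in 𝓝 s, χ r = 1 := eventually_nhdsSet_iff_forall.1 h1 s hs
    refine (contDiffAt_const (c := (0 : X →L[ℂ] X))).congr_of_eventuallyEq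
      (this.mono fun r hr => ?_)
    simp [hr]
  · have h2 : ContDiffAt ℝ 3 (fun s => 1 - χ s) s :=
      contDiffAt_const.sub (contDiff_infty.1 hχ 3).contDiffAt
    exact h2.smul (contDiffAt_axisResolvent hs)

/-- Off a neighbourhood of the imaginary spectrum, a resolvent decaying with order `θ > 1/2` is an
`L¹` Fourier multiplier. -/
theorem exists_integrable_fourier_eq_cutoff_resolvent {A : X →ₗ.[ℂ] X} {a θ M : ℝ} (ha : 0 < a)
    (hθ : 1 / 2 < θ) (hσ : ∀ t : ℝ, a ≤ |t| → Complex.I * (t : ℂ) ∉ opSpectrum A)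
    (hM : ∀ t : ℝ, a ≤ |t| → |t| ^ θ * ‖opResolvent A (Complex.I * (t : ℂ))‖ ≤ M)
    {χ : ℝ → ℂ} (hχ : ContDiff ℝ (⊤ : ℕ∞) χ) (hχc : HasCompactSupport χ)
    (h1 : ∀ᶠ s in 𝓝ˢ {s : ℝ | Complex.I * ((2 * Real.pi * s : ℝ) : ℂ) ∈ opSpectrum A}, χ s = 1) :
    ∃ G : ℝ → X →L[ℂ] X, Integrable G ∧ 𝓕 G = fun s => (1 - χ s) • axisResolvent A s := by
  set m : ℝ → X →L[ℂ] X := fun s => (1 - χ s) • axisResolvent A s with hm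
  have hmc : ContDiff ℝ 3 m := contDiff_cutoff_smul_axisResolvent hχ h1
  have hθ0 : 0 < θ := by linarith
  obtain ⟨b₀, hb₀⟩ := hχc.isCompact.isBounded.subset_closedBall 0
  -- Beyond `b` the cutoff vanishes, the resolvent bound applies, and `|s| ≥ 1` allows powers to be
  -- compared.
  set b := max b₀ (max a 1) with hb
  have hb1 : 1 ≤ b := (le_max_right _ _).trans (le_max_right _ _)
  have hba : a ≤ b := (le_max_left _ _).trans (le_max_right _ _)
  have hχ0 : ∀ s, b < |s| → χ s = 0 := by
    intro s hs
    by_contra hne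
    have := hb₀ (subset_tsupport χ hne)
    rw [mem_closedBall_zero_iff, Real.norm_eq_abs] at this
    exact absurd (this.trans (le_max_left _ _)) (not_le.2 hs)
  have hbig : ∀ s : ℝ, b < |s| → |s| ≤ |2 * Real.pi * s| := by
    intro s hs
    rw [abs_mul, abs_of_pos Real.two_pi_pos]
    nlinarith [Real.pi_gt_three, abs_nonneg s]
  have hσ' : ∀ s : ℝ, b < |s| → Complex.I * ((2 * Real.pi * s : ℝ) : ℂ) ∉ opSpectrum A :=
    fun s hs => hσ _ (hba.trans (hs.le.trans (hbig s hs)))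
  have hmS : ∀ s, b < |s| → m s = axisResolvent A s := fun s hs => by simp [hm, hχ0 s hs]
  have hM0 : 0 ≤ M := by
    refine le_trans ?_ (hM a (le_abs_self a))
    positivity
  have hS : ∀ s, b < |s| → ‖axisResolvent A s‖ ≤ M * |s| ^ (-θ) := by
    intro s hs
    have hs0 : 0 < |s| := by linarith
    have h2 := hM _ (hba.trans (hs.le.trans (hbig s hs)))
    rw [Real.rpow_neg hs0.le, ← div_eq_mul_inv, le_div_iff₀ (by positivity), mul_comm]
    refine le_trans ?_ h2
    refine mul_le_mul_of_nonneg_right ?_ (norm_nonneg _)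
    exact Real.rpow_le_rpow hs0.le (hbig s hs) hθ0.le
  have hlim : Tendsto m (cocompact ℝ) (𝓝 0) := by
    rw [tendsto_zero_iff_norm_tendsto_zero]
    have h3 : Tendsto (fun s : ℝ => M * |s| ^ (-θ)) (cocompact ℝ) (𝓝 0) := by
      have := ((tendsto_rpow_neg_atTop hθ0).comp (tendsto_norm_cocompact_atTop (E := ℝ))).const_mul M
      simpa using this
    refine squeeze_zero' (Eventually.of_forall fun s => norm_nonneg _) ?_ h3
    have hev : ∀ᶠ s : ℝ in cocompact ℝ, b < ‖s‖ :=
      (tendsto_norm_cocompact_atTop (E := ℝ)).eventually (eventually_gt_atTop b)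
    filter_upwards [hev] with s hs
    rw [hmS s hs]
    exact hS s hs
  -- The restriction `1 ≤ k` is essential: the power `k + 1 ≥ 2` of the resolvent brings the order
  -- to at least `2θ`. On `[-b, b]` continuity suffices.
  have hbound : ∀ k : ℕ, 1 ≤ k → k ≤ 3 →
      ∃ C : ℝ, ∀ s, ‖iteratedDeriv k m s‖ ≤ C * (1 + |s|) ^ (-(2 * θ)) := by
    intro k hk1 hk3
    obtain ⟨c, hc⟩ := exists_iteratedDeriv_eq_smul_axisResolvent_pow hσ' hmS k
    have hcont : Continuous fun s => (1 + |s|) ^ (2 * θ) • iteratedDeriv k m s := by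
      have h4 := hmc.continuous_iteratedDeriv k (by exact_mod_cast hk3)
      have h5 : Continuous fun s : ℝ => (1 + |s|) ^ (2 * θ) :=
        (continuous_const.add continuous_abs).rpow_const fun s => Or.inr (by positivity)
      exact h5.smul h4
    obtain ⟨D, hD⟩ := isCompact_Icc (a := -b) (b := b) |>.exists_bound_of_continuousOn
      hcont.continuousOn
    refine ⟨max D (‖c‖ * M ^ (k + 1) * 2 ^ (2 * θ)), fun s => ?_⟩
    have hpos : 0 < 1 + |s| := by positivity
    rcases le_or_gt |s| b with hs | hs
    · have h5 := hD s (abs_le.1 hs)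
      rw [norm_smul, Real.norm_of_nonneg (by positivity)] at h5
      rw [Real.rpow_neg hpos.le, ← div_eq_mul_inv, le_div_iff₀ (by positivity), mul_comm]
      exact h5.trans (le_max_left _ _)
    · have hs1 : 1 ≤ |s| := hb1.trans hs.le
      have hs0 : 0 < |s| := by linarith
      have e1 : (|s| ^ (-θ)) ^ (k + 1) ≤ |s| ^ (-(2 * θ)) := by
        rw [← Real.rpow_natCast, ← Real.rpow_mul hs0.le]
        refine Real.rpow_le_rpow_of_exponent_le hs1 ?_
        have : (1 : ℝ) ≤ k := by exact_mod_cast hk1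
        push_cast
        nlinarith
      have e2 : |s| ^ (-(2 * θ)) ≤ 2 ^ (2 * θ) * (1 + |s|) ^ (-(2 * θ)) := by
        rw [Real.rpow_neg hs0.le, Real.rpow_neg hpos.le, ← div_eq_mul_inv,
          ← Real.div_rpow (by norm_num) hpos.le, ← Real.inv_rpow hs0.le]
        refine Real.rpow_le_rpow (by positivity) ?_ (by positivity)
        rw [inv_eq_one_div, div_le_div_iff₀ hs0 hpos]
        linarith
      calc ‖iteratedDeriv k m s‖ ≤ ‖c‖ * (M * |s| ^ (-θ)) ^ (k + 1) := by
            rw [hc s hs, norm_smul]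
            gcongr
            exact (norm_pow_le' _ (Nat.succ_pos k)).trans (by gcongr; exact hS s hs)
        _ = ‖c‖ * M ^ (k + 1) * (|s| ^ (-θ)) ^ (k + 1) := by rw [mul_pow]; ring
        _ ≤ ‖c‖ * M ^ (k + 1) * (2 ^ (2 * θ) * (1 + |s|) ^ (-(2 * θ))) := by
            gcongr; exact e1.trans e2
        _ = ‖c‖ * M ^ (k + 1) * 2 ^ (2 * θ) * (1 + |s|) ^ (-(2 * θ)) := by ring
        _ ≤ _ := by gcongr; exact le_max_right _ _
  obtain ⟨C₁, hC₁⟩ := hbound 1 le_rfl (by norm_num)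
  obtain ⟨C₂, hC₂⟩ := hbound 2 (by norm_num) (by norm_num)
  obtain ⟨C₃, hC₃⟩ := hbound 3 (by norm_num) le_rfl
  refine exists_integrable_fourier_eq_of_decay hmc hlim (p := 2 * θ) (C := max C₁ (max C₂ C₃))
    (by linarith) fun k hk1 hk3 s => ?_
  interval_cases k
  · exact (hC₁ s).trans (by gcongr; exact le_max_left _ _)
  · exact (hC₂ s).trans (by gcongr; exact (le_max_left _ _).trans (le_max_right _ _))
  · exact (hC₃ s).trans (by gcongr; exact (le_max_right _ _).trans (le_max_right _ _))

end Multiplier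

/-! ### The integrated equation with the unbounded operator inverted. -/

section MildSolution

theorem fourier_clm_comp {E F : Type*} [NormedAddCommGroup E] [NormedSpace ℂ E]
    [NormedAddCommGroup F] [NormedSpace ℂ F] [CompleteSpace E] [CompleteSpace F]
    (L : E →L[ℂ] F) {f : ℝ → E} (hf : Integrable f) (s : ℝ) :
    𝓕 (fun t => L (f t)) s = L (𝓕 f s) := by
  have h : Integrable fun x => Real.fourierChar (-(x * s)) • f x := by
    have := (Real.fourierIntegral_convergent_iff (μ := volume) (f := f) s).2 hf
    simpa [mul_comm] using this
  rw [Real.fourier_real_eq, Real.fourier_real_eq, ← L.integral_comp_comm h]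
  congr 1; ext t
  simp only [Circle.smul_def, map_smul]

theorem fourier_comp_sub_right {E : Type*} [NormedAddCommGroup E] [NormedSpace ℂ E]
    (f : ℝ → E) (τ s : ℝ) :
    𝓕 (fun t => f (t - τ)) s = (Real.fourierChar (-(τ * s)) : ℂ) • 𝓕 f s := by
  rw [Real.fourier_real_eq, Real.fourier_real_eq, ← integral_smul,
    ← integral_sub_right_eq_self (fun t : ℝ =>
      (Real.fourierChar (-(τ * s)) : ℂ) • Real.fourierChar (-(t * s)) • f t) τ]
  congr 1; ext t
  rw [show -(t * s) = -(τ * s) + -((t - τ) * s) by ring, AddChar.map_add_eq_mul]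
  simp only [Circle.smul_def, mul_smul]

/-- The factor `2πis` stays on the left, so `s = 0` needs no separate treatment. -/
theorem mul_fourier_indicator_Ioc {τ : ℝ} (hτ : 0 ≤ τ) (s : ℝ) :
    (2 * Real.pi * Complex.I * s) * 𝓕 (indicator (Ioc 0 τ) fun _ => (1 : ℂ)) s =
      1 - (Real.fourierChar (-(τ * s)) : ℂ) := by
  have h1 : 𝓕 (indicator (Ioc 0 τ) fun _ => (1 : ℂ)) s =
      ∫ r in (0 : ℝ)..τ, (Real.fourierChar (-(r * s)) : ℂ) := by
    rw [Real.fourier_real_eq, intervalIntegral.integral_of_le hτ,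
      ← integral_indicator measurableSet_Ioc]
    congr 1; ext t
    by_cases ht : t ∈ Ioc 0 τ <;> simp [ht, Circle.smul_def]
  have hd : ∀ r : ℝ, HasDerivAt (fun r : ℝ => -(Real.fourierChar (-(r * s)) : ℂ))
      ((2 * Real.pi * Complex.I * s) * (Real.fourierChar (-(r * s)) : ℂ)) r := by
    intro r
    have h2 : HasDerivAt (fun r : ℝ => -(r * s)) (-s) r := by
      simpa [Pi.neg_def] using ((hasDerivAt_id r).mul_const s).neg
    have := ((Real.hasDerivAt_fourierChar (-(r * s))).scomp r h2).neg
    refine this.congr_deriv ?_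
    rw [← Complex.coe_smul]
    simp only [smul_eq_mul]
    push_cast
    ring
  have hc := Real.continuous_fourierChar
  rw [h1, ← intervalIntegral.integral_const_mul,
    intervalIntegral.integral_eq_sub_of_hasDerivAt (fun r _ => hd r)
      (Continuous.intervalIntegrable (by fun_prop) _ _)]
  simp
  ring

theorem indicator_Ioc_convolution {E : Type*} [NormedAddCommGroup E] [NormedSpace ℂ E]
    {τ : ℝ} (hτ : 0 ≤ τ) (w : ℝ → E) (x : ℝ) :
    ((indicator (Ioc 0 τ) fun _ => (1 : ℂ)) ⋆[ContinuousLinearMap.lsmul ℂ ℂ] w) x =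
      ∫ r in (x - τ)..x, w r := by
  have h := intervalIntegral.integral_comp_sub_left (a := 0) (b := τ) w x
  rw [sub_zero] at h
  rw [← h, intervalIntegral.integral_of_le hτ, ← integral_indicator measurableSet_Ioc,
    convolution_def]
  congr 1; ext t
  by_cases ht : t ∈ Ioc 0 τ <;> simp [ht]

variable {X : Type*} [NormedAddCommGroup X] [NormedSpace ℂ X] [CompleteSpace X]

theorem clm_mul_convolution {φ : ℝ → X} (B : X →L[ℂ] X) {g : ℝ → X →L[ℂ] X} {x : ℝ}
    (h : ConvolutionExistsAt g φ x (ContinuousLinearMap.id ℂ (X →L[ℂ] X)) volume) :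
    ((fun r => B * g r) ⋆[ContinuousLinearMap.id ℂ (X →L[ℂ] X)] φ) x =
      B ((g ⋆[ContinuousLinearMap.id ℂ (X →L[ℂ] X)] φ) x) := by
  rw [convolution_def, convolution_def, ← B.integral_comp_comm h]
  rfl

theorem smul_clm_convolution {φ : ℝ → X} (B : X →L[ℂ] X) {g : ℝ → ℂ} {x : ℝ}
    (h : ConvolutionExistsAt g φ x (ContinuousLinearMap.lsmul ℂ ℂ) volume) :
    ((fun r => g r • B) ⋆[ContinuousLinearMap.id ℂ (X →L[ℂ] X)] φ) x =
      B ((g ⋆[ContinuousLinearMap.lsmul ℂ ℂ] φ) x) := by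
  rw [convolution_def, convolution_def, ← B.integral_comp_comm h]
  congr 1; ext t
  simp

theorem translate_convolution {X : Type*} [NormedAddCommGroup X] [NormedSpace ℂ X] {φ : ℝ → X} (g : ℝ → X →L[ℂ] X) (τ x : ℝ) :
    ((fun r => g (r - τ)) ⋆[ContinuousLinearMap.id ℂ (X →L[ℂ] X)] φ) x =
      (g ⋆[ContinuousLinearMap.id ℂ (X →L[ℂ] X)] φ) (x - τ) := by
  rw [convolution_def, convolution_def, ← integral_sub_right_eq_self
    (fun t => ContinuousLinearMap.id ℂ (X →L[ℂ] X) (g t) (φ (x - τ - t))) τ]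
  congr 1; ext t
  rw [show x - τ - (t - τ) = x - t by ring]

/-- The two sides differ by `e (1 - c)` times the resolvent identity. In use, `w = 2πis`, `c` is the
cutoff and `e` the transform of the indicator of `(0, τ]`. -/
theorem multiplier_identity {X : Type*} [NormedAddCommGroup X] [NormedSpace ℂ X] {R S : X →L[ℂ] X} {z w : ℂ} (h : S = R + (z - w) • (R * S))
    (c e : ℂ) : R * ((1 - c) • S) + -R * ((1 - w * e) • (1 - c) • S) =
      e • R + (e * c) • (-R) + (z • R - 1) * (e • (1 - c) • S) := by
  simp only [mul_smul_comm, sub_mul, smul_mul_assoc, one_mul, neg_mul]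
  generalize R * S = T at *
  subst h
  module

/-- The integrated equation for a fundamental solution `G`, in a form where the unbounded operator
has been inverted. -/
theorem fundamental_solution_ae_eq {A : X →ₗ.[ℂ] X} {k : ℝ → ℂ} (hk : Integrable k)
    (hkσ : ∀ s : ℝ, Complex.I * ((2 * Real.pi * s : ℝ) : ℂ) ∈ opSpectrum A → 𝓕 k s = 1)
    {G : ℝ → X →L[ℂ] X} (hG : Integrable G)
    (hGm : 𝓕 G = fun s => (1 - 𝓕 k s) • axisResolvent A s) {z : ℂ} {R : X →L[ℂ] X}
    (hR : IsResolventAt A z R) {τ : ℝ} (hτ0 : 0 ≤ τ) {e : ℝ → ℂ}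
    (he : e = indicator (Ioc 0 τ) fun _ => (1 : ℂ)) (hei : Integrable e) :
    ((fun r => R * G r) + fun r => (-R) * G (r - τ)) =ᵐ[volume]
      (((fun r => e r • R) + fun r => (e ⋆[ContinuousLinearMap.mul ℂ ℂ] k) r • (-R)) +
        fun r => (z • R - 1) * (e ⋆[ContinuousLinearMap.lsmul ℂ ℂ] G) r) := by
  have hek : Integrable (e ⋆[ContinuousLinearMap.mul ℂ ℂ] k) := hei.integrable_convolution _ hk
  have heG : Integrable (e ⋆[ContinuousLinearMap.lsmul ℂ ℂ] G) := hei.integrable_convolution _ hG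
  have hGτ : Integrable fun r => G (r - τ) := hG.comp_sub_right τ
  have i1 : Integrable fun r => R * G r := hG.const_mul R
  have i2 : Integrable fun r => (-R) * G (r - τ) := hGτ.const_mul (-R)
  have j1 : Integrable fun r => e r • R := hei.smul_const R
  have j2 : Integrable fun r => (e ⋆[ContinuousLinearMap.mul ℂ ℂ] k) r • (-R) := hek.smul_const _
  have j3 : Integrable fun r => (z • R - 1) * (e ⋆[ContinuousLinearMap.lsmul ℂ ℂ] G) r :=
    heG.const_mul _
  refine ae_eq_of_fourier_eq (i1.add i2) ((j1.add j2).add j3) ?_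
  rw [fourier_add_of_integrable i1 i2, fourier_add_of_integrable (j1.add j2) j3,
    fourier_add_of_integrable j1 j2]
  ext1 s
  have f1 := fourier_clm_comp (ContinuousLinearMap.mul ℂ (X →L[ℂ] X) R) hG s
  have f2 := fourier_clm_comp (ContinuousLinearMap.mul ℂ (X →L[ℂ] X) (-R)) hGτ s
  have f3 := fourier_clm_comp
    ((ContinuousLinearMap.lsmul ℂ ℂ : ℂ →L[ℂ] (X →L[ℂ] X) →L[ℂ] (X →L[ℂ] X)).flip R) hei s
  have f4 := fourier_clm_comp
    ((ContinuousLinearMap.lsmul ℂ ℂ : ℂ →L[ℂ] (X →L[ℂ] X) →L[ℂ] (X →L[ℂ] X)).flip (-R)) hek s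
  have f5 := fourier_clm_comp (ContinuousLinearMap.mul ℂ (X →L[ℂ] X) (z • R - 1)) heG s
  simp only [ContinuousLinearMap.mul_apply', ContinuousLinearMap.flip_apply,
    ContinuousLinearMap.lsmul_apply] at f1 f2 f3 f4 f5
  simp only [Pi.add_apply]
  rw [f1, f2, f3, f4, f5, fourier_comp_sub_right, Real.fourier_mul_convolution_eq hei hk,
    Real.fourier_smul_convolution_eq hei hG, hGm]
  dsimp only
  have hE : (Real.fourierChar (-(τ * s)) : ℂ) =
      1 - (2 * Real.pi * Complex.I * s) * 𝓕 e s := by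
    rw [he, mul_fourier_indicator_Ioc hτ0]; ring
  rw [hE]
  -- At a spectral point the cutoff is `1`: the terms with `G` vanish and the two terms with `R`
  -- cancel.
  by_cases hs : Complex.I * ((2 * Real.pi * s : ℝ) : ℂ) ∈ opSpectrum A
  · simp [hkσ s hs]
  · have hres := hR.resolvent_identity (opResolvent_spec hs)
    rw [show Complex.I * ((2 * Real.pi * s : ℝ) : ℂ) = 2 * Real.pi * Complex.I * s by
      push_cast; ring] at hres
    have hS : axisResolvent A s = opResolvent A (2 * Real.pi * Complex.I * s) := by
      rw [axisResolvent]; congr 1; push_cast; ring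
    rw [hS]
    exact multiplier_identity hres _ _

/-- The convolution of a fundamental solution with `φ` satisfies the integrated equation, in a form
where the unbounded operator has been inverted. -/
theorem resolvent_apply_convolution_sub {A : X →ₗ.[ℂ] X} {φ : ℝ → X}
    (hφ : AEStronglyMeasurable φ) {C : ℝ} (hC : ∀ᵐ x, ‖φ x‖ ≤ C) {k : ℝ → ℂ} (hk : Integrable k)
    (hkφ : convolution k φ (ContinuousLinearMap.lsmul ℂ ℂ) volume = 0)
    (hkσ : ∀ s : ℝ, Complex.I * ((2 * Real.pi * s : ℝ) : ℂ) ∈ opSpectrum A → 𝓕 k s = 1)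
    {G : ℝ → X →L[ℂ] X} (hG : Integrable G)
    (hGm : 𝓕 G = fun s => (1 - 𝓕 k s) • axisResolvent A s) {z : ℂ} {R : X →L[ℂ] X}
    (hR : IsResolventAt A z R) {u : ℝ → X}
    (hu : u = G ⋆[ContinuousLinearMap.id ℂ (X →L[ℂ] X)] φ) {x y : ℝ} (hxy : x ≤ y) :
    R (u y - u x) = R (∫ r in x..y, φ r) + (z • R - 1) (∫ r in x..y, u r) := by
  obtain ⟨τ, hτ⟩ : ∃ τ, τ = y - x := ⟨_, rfl⟩
  have hτ0 : 0 ≤ τ := hτ ▸ sub_nonneg.2 hxy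
  obtain ⟨e, he⟩ : ∃ e : ℝ → ℂ, e = indicator (Ioc 0 τ) fun _ => (1 : ℂ) := ⟨_, rfl⟩
  have hei : Integrable e := by
    rw [he, integrable_indicator_iff measurableSet_Ioc]
    exact integrableOn_const (by simp)
  have hek : Integrable (e ⋆[ContinuousLinearMap.mul ℂ ℂ] k) := hei.integrable_convolution _ hk
  have heG : Integrable (e ⋆[ContinuousLinearMap.lsmul ℂ ℂ] G) := hei.integrable_convolution _ hG
  have hGτ : Integrable fun r => G (r - τ) := hG.comp_sub_right τ
  have ex : ∀ {g : ℝ → X →L[ℂ] X}, Integrable g →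
      ConvolutionExistsAt g φ y (ContinuousLinearMap.id ℂ (X →L[ℂ] X)) volume := fun hg =>
    convolutionExistsAt_of_integrable_of_bdd _ hg hφ hC y
  have ex' : ∀ {g : ℝ → ℂ}, Integrable g →
      ConvolutionExistsAt g φ y (ContinuousLinearMap.lsmul ℂ ℂ) volume := fun hg =>
    convolutionExistsAt_of_integrable_of_bdd _ hg hφ hC y
  have x1 := ex (hG.const_mul R)
  have x2 := ex (hGτ.const_mul (-R))
  have x3 := ex (hei.smul_const R)
  have x4 := ex (hek.smul_const (-R))
  have x5 := ex (heG.const_mul (z • R - 1))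
  have hc := congrFun (convolution_congr_left (ContinuousLinearMap.id ℂ (X →L[ℂ] X)) φ
    (fundamental_solution_ae_eq hk hkσ hG hGm hR hτ0 he hei)) y
  rw [x1.add_distrib x2, ConvolutionExistsAt.add_distrib
    (ex ((hei.smul_const R).add (hek.smul_const (-R)))) x5, x3.add_distrib x4,
    clm_mul_convolution R (ex hG), clm_mul_convolution (-R) (ex hGτ),
    smul_clm_convolution R (ex' hei), smul_clm_convolution (-R) (ex' hek),
    clm_mul_convolution _ (ex heG), translate_convolution] at hc
  have a1 := convolution_assoc_of_bdd (ContinuousLinearMap.mul ℂ ℂ)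
    (ContinuousLinearMap.lsmul ℂ ℂ) (ContinuousLinearMap.lsmul ℂ ℂ)
    (ContinuousLinearMap.lsmul ℂ ℂ : ℂ →L[ℂ] X →L[ℂ] X)
    (fun x y z => mul_smul x y z) hei hk hφ hC
  have a2 := convolution_assoc_of_bdd
    (ContinuousLinearMap.lsmul ℂ ℂ : ℂ →L[ℂ] (X →L[ℂ] X) →L[ℂ] (X →L[ℂ] X))
    (ContinuousLinearMap.id ℂ (X →L[ℂ] X)) (ContinuousLinearMap.lsmul ℂ ℂ)
    (ContinuousLinearMap.id ℂ (X →L[ℂ] X)) (fun x y z => rfl) hei hG hφ hC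
  -- Here the cutoff disappears from the equation: `(e ⋆ k) ⋆ φ = e ⋆ (k ⋆ φ) = 0`.
  rw [hkφ, convolution_zero] at a1
  have hyτ : y - τ = x := by rw [hτ, sub_sub_cancel]
  rw [a1, a2, he, indicator_Ioc_convolution hτ0, indicator_Ioc_convolution hτ0, hyτ] at hc
  rw [hu, map_sub, sub_eq_add_neg]
  rw [Pi.zero_apply, map_zero, add_zero, neg_apply] at hc
  exact hc

end MildSolution

end EvolutionEquation

/-! ### Assembly of the mild solution. -/

open EvolutionEquation in
theorem corollary5p5 {X : Type*} [NormedAddCommGroup X] [NormedSpace ℂ X] [CompleteSpace X]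
    (T : EvolutionEquation.C0Semigroup X)
    (a : ℝ) (ha : 0 < a)
    (hK : EvolutionEquation.imagSpectrum T.generator ⊆ Set.Ioo (-a) a)
    (θ : ℝ) (hθ : 1 / 2 < θ)
    (hR : BddAbove ((fun t : ℝ =>
      |t| ^ θ * ‖EvolutionEquation.opResolvent T.generator (Complex.I * (t : ℂ))‖) ''
        (Set.Ioo (-a) a)ᶜ))
    (φ : ℝ → X) (hφ : MemLp φ ⊤ volume)
    (hsp : (fun ω : ℝ => Complex.I * (ω : ℂ)) '' EvolutionEquation.beurlingSpectrum φ ∩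
      EvolutionEquation.opSpectrum T.generator = ∅) :
    ∃ u : ℝ → X, u ∈ EvolutionEquation.BUC X ∧
      EvolutionEquation.IsMildSolution T.generator φ u := by
  set A := T.generator
  have hmem : ∀ t : ℝ, a ≤ |t| → t ∉ Set.Ioo (-a) a := fun t ht h =>
    absurd (abs_lt.2 h) (not_lt.2 ht)
  have hσ : ∀ t : ℝ, a ≤ |t| → Complex.I * (t : ℂ) ∉ opSpectrum A := fun t ht h =>
    hmem t ht (hK h)
  obtain ⟨M, hM⟩ := hR
  have hM' : ∀ t : ℝ, a ≤ |t| → |t| ^ θ * ‖opResolvent A (Complex.I * (t : ℂ))‖ ≤ M :=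
    fun t ht => hM ⟨t, hmem t ht, rfl⟩
  have hφm : AEStronglyMeasurable φ := hφ.1
  obtain ⟨C, hC⟩ : ∃ C : ℝ, ∀ᵐ x, ‖φ x‖ ≤ C := by
    refine ⟨(eLpNorm φ ⊤ volume).toReal, ?_⟩
    rw [eLpNorm_exponent_top]
    have hfin : eLpNormEssSup φ volume ≠ ⊤ := by simpa using hφ.2.ne
    filter_upwards [enorm_ae_le_eLpNormEssSup φ volume] with x hx
    simpa using ENNReal.toReal_mono hfin hx
  have hKc : IsCompact {s : ℝ | Complex.I * ((2 * Real.pi * s : ℝ) : ℂ) ∈ opSpectrum A} := by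
    refine Metric.isCompact_of_isClosed_isBounded ?_ ?_
    · exact (isClosed_opSpectrum A).preimage (by fun_prop)
    · refine (Metric.isBounded_Icc (-a) a).subset fun s hs => ?_
      have h1 : 2 * Real.pi * s ∈ Set.Ioo (-a) a := hK hs
      refine abs_le.1 ?_
      have h2 := abs_lt.2 h1
      rw [abs_mul, abs_of_pos Real.two_pi_pos] at h2
      nlinarith [Real.pi_gt_three, abs_nonneg s]
  -- A spectral point lies outside `sp(φ)`, which supplies an annihilating `f` with nonzero
  -- transform there; the factor `2π` converts angular frequency to the normalization of `𝓕`.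
  obtain ⟨k, hk, hkφ, hks, hkc, hk1⟩ := exists_annihilating_cutoff hφm hC hKc (by
    intro s hs
    have h1 : (2 * Real.pi * s) ∉ beurlingSpectrum φ := fun h => by
      have : Complex.I * ((2 * Real.pi * s : ℝ) : ℂ) ∈ (∅ : Set ℂ) := by
        rw [← hsp]; exact ⟨⟨_, h, rfl⟩, hs⟩
      exact this
    simp only [beurlingSpectrum, Set.mem_ofPred_eq, not_forall] at h1
    obtain ⟨f, hf, hfφ, hne⟩ := h1
    refine ⟨f, hf, hfφ, fun h0 => hne ?_⟩
    rw [← h0, Real.fourier_real_eq_integral_exp_smul]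
    congr 1; ext t
    rw [smul_eq_mul, mul_comm]
    congr 2
    push_cast
    ring)
  have hk1' : ∀ s : ℝ, Complex.I * ((2 * Real.pi * s : ℝ) : ℂ) ∈ opSpectrum A →
      FourierTransform.fourier k s = 1 := fun s hs =>
    (eventually_nhdsSet_iff_forall.1 hk1 s hs).self_of_nhds
  obtain ⟨G, hG, hGm⟩ := exists_integrable_fourier_eq_cutoff_resolvent ha hθ hσ hM' hks hkc hk1
  -- Any point of the resolvent set would serve; `ia` is one by assumption.
  have hz : IsResolventAt A (Complex.I * (a : ℂ)) (opResolvent A (Complex.I * (a : ℂ))) :=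
    opResolvent_spec (hσ a (le_abs_self a))
  set z := Complex.I * (a : ℂ)
  set R := opResolvent A z
  set u : ℝ → X := convolution G φ (ContinuousLinearMap.id ℂ (X →L[ℂ] X)) volume with hu
  have huc : UniformContinuous u := uniformContinuous_convolution _ hG hφm hC
  have key : ∀ t : ℝ, R (u t - u 0) =
      R (∫ r in (0 : ℝ)..t, φ r) + (z • R - 1) (∫ r in (0 : ℝ)..t, u r) := by
    intro t
    rcases le_total 0 t with ht | ht
    · exact resolvent_apply_convolution_sub hφm hC hk hkφ hk1' hG hGm hz hu ht
    · have := resolvent_apply_convolution_sub hφm hC hk hkφ hk1' hG hGm hz hu ht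
      rw [← neg_sub, map_neg, this, intervalIntegral.integral_symm 0 t,
        intervalIntegral.integral_symm 0 t (f := u), map_neg, map_neg]
      abel
  -- Solving `key` for the integral exhibits it in the range of `R`, which gives membership in
  -- `D(A)` and, after applying `z - A`, the equation itself.
  have hy : ∀ t : ℝ, (∫ r in (0 : ℝ)..t, u r) =
      R (z • (∫ r in (0 : ℝ)..t, u r) - (u t - u 0) + ∫ r in (0 : ℝ)..t, φ r) := by
    intro t
    rw [map_add, map_sub, key t, map_smul, sub_apply, smul_apply, one_apply_eq_self]
    abel
  refine ⟨u, ⟨⟨_, norm_convolution_le_of_bdd _ hG hC⟩, huc⟩, huc.continuous, ?_⟩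
  have hdom : ∀ t : ℝ, (∫ r in (0 : ℝ)..t, u r) ∈ A.domain := fun t => by
    rw [hy t]; exact (hz.1 _).1
  refine ⟨hdom, fun t => ?_⟩
  obtain ⟨h1, h2⟩ := hz.1 (z • (∫ r in (0 : ℝ)..t, u r) - (u t - u 0) + ∫ r in (0 : ℝ)..t, φ r)
  have h3 : A ⟨∫ r in (0 : ℝ)..t, u r, hdom t⟩ = A ⟨_, h1⟩ := by
    congr 1; exact Subtype.ext (hy t)
  have h4 : z • (∫ r in (0 : ℝ)..t, u r) - A ⟨_, h1⟩ =
      z • (∫ r in (0 : ℝ)..t, u r) - (u t - u 0) + ∫ r in (0 : ℝ)..t, φ r :=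
    (congrArg (fun v => z • v - A ⟨_, h1⟩) (hy t)).trans h2
  have h5 : A ⟨_, h1⟩ = (u t - u 0) - ∫ r in (0 : ℝ)..t, φ r := by
    rw [← sub_sub_cancel (z • ∫ r in (0 : ℝ)..t, u r) (A ⟨_, h1⟩), h4]
    abel
  rw [h3, h5]
  abel
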